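/- Theorem 3.1. The \emph{tropical rank} $\mathrm{rk}_t(A)$ of a real matrix $A$ is the largest $r$ such that $A$ has an $r\times r$ submatrix $S$ for which the minimum $\min_{\sigma\in\mathcal S_r}\sum_i s_{i,\sigma(i)}$ is attained by exactly one permutation. Let $\mathbf K$ be the field of formal sums $\sum_{e\in\mathbb R}a_et^e$ with $a_e\in\mathbb C$ and well-ordered support; the degree of such a sum is the least exponent in its support (the degree of $0$ is $\infty$). The \emph{Kapranov rank} $\mathrm{rk}_K(A)$ is the smallest rank of a matrix over $\mathbf K$ of the same size whose entrywise degree is $A$. The \emph{pattern} $\mathcal P(A)$ of a real matrix $A$ is the $\{0,\infty\}$-matrix of the same size whose $(u,v)$ entry is $0$ if $a_{uv}=\min_i a_{iv}$ and $\infty$ otherwise. The \emph{support} of a column of a pattern is the set of the row indices at which the column has a $0$. Two real matrices are \emph{equivalent} if one is obtained from the other by permuting rows, permuting columns, and adding real constants to rows and to columns. Let $A\in\mathbb R^{6\times n}$ be such that $\mathrm{rk}_t(A)=3$ and $\mathrm{rk}_K(A)>3$. Then $A$ is equivalent to a matrix $W\in\mathbb R^{6\times n}$ such that every row of $\mathcal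 P(W)$ contains at least one $0$, and at least one of the following conditions holds: (i) the set of the supports of the columns of $\mathcal P(W)$ is $\{\{1,2\},\{3,4\},\{5,6\}\}$; (ii) $\{1,2\}$ is the support of a column of $\mathcal P(W)$, at least one of $\{4,5,6\}$, $\{3,4,6\}$, $\{3,5,6\}$, $\{3,4,5\}$ is the support of a column of $\mathcal P(W)$, and the support of every column of $\mathcal P(W)$ is one of $\{1,2\}$, $\{4,5,6\}$, $\{3,4,6\}$, $\{3,5,6\}$, $\{3,4,5\}$, $\{3,4,5,6\}$; (iii) the support of every column of $\mathcal P(W)$ either is one of $\{1,2,3\}$, $\{1,4,5\}$, $\{2,4,6\}$, $\{3,5,6\}$ (each of which may or may not occur) or has cardinality at least $4$; and if the support of a column of $\mathcal P(W)$ has cardinality $4$, then no proper subset of it is the support of a column of $\mathcal P(W)$; (iv) $\{1,2,3\}$ and $\{4,5,6\}$ are supports of columns of $\mathcal P(W)$, and the support of any column of $\mathcal P(W)$ that is different from these two sets contains at least two elements of $\{1,2,3\}$ and at least two elements of $\{4,5,6\}$; (v) the set of the supports of the columns of $\mathcal P(W)$ is $\{\{1,2\},\{1,2,3\},\{4,5,6\}\}$.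 -/

import Mathlib

namespace Tropical3p1

/-- The weight `s_{1,σ(1)} + … + s_{r,σ(r)}` of a permutation `σ`. -/
noncomputable def permWeight {r : ℕ} (S : Matrix (Fin r) (Fin r) ℝ) (σ : Equiv.Perm (Fin r)) : ℝ :=
  ∑ i, S i (σ i)

/-- The tropical permanent. -/
noncomputable def tropPerm {r : ℕ} (S : Matrix (Fin r) (Fin r) ℝ) : ℝ :=
  Finset.univ.inf' Finset.univ_nonempty (permWeight S)

/-- The minimum defining the tropical permanent is attained at least twice. -/
def IsTropSingular {r : ℕ} (S : Matrix (Fin r) (Fin r) ℝ) : Prop :=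
  ∃ σ τ : Equiv.Perm (Fin r), σ ≠ τ ∧ permWeight S σ = tropPerm S ∧ permWeight S τ = tropPerm S

/-- The tropical rank: the largest size of a tropically non-singular square submatrix.
(The set is bounded by `m` and contains `0`.) -/
noncomputable def tropRank {m n : ℕ} (A : Matrix (Fin m) (Fin n) ℝ) : ℕ :=
  sSup {r : ℕ | ∃ (f : Fin r ↪ Fin m) (g : Fin r ↪ Fin n), ¬ IsTropSingular (A.submatrix f g)}

/-- The field of formal sums `∑ a_e t^e`, `e ∈ ℝ`, `a_e ∈ ℂ`, with well-ordered support.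
The degree map is `HahnSeries.orderTop`, with values in `ℝ ∪ {∞}`. -/
abbrev K : Type := HahnSeries ℝ ℂ

/-- `F` is a lift of the real matrix `B`, i.e. `deg F = B` entrywise. -/
def IsLift {m n : ℕ} (F : Matrix (Fin m) (Fin n) K) (B : Matrix (Fin m) (Fin n) ℝ) : Prop :=
  ∀ i j, (F i j).orderTop = ((B i j : ℝ) : WithTop ℝ)

/-- The Kapranov rank: the smallest rank of a lift. -/
noncomputable def kapranovRank {m n : ℕ} (B : Matrix (Fin m) (Fin n) ℝ) : ℕ :=
  sInf {r : ℕ | ∃ F : Matrix (Fin m) (Fin n) K, IsLift F B ∧ F.rank = r}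

/-- The pattern of a real matrix, a matrix over `{0, ∞} ⊆ ℝ ∪ {∞}`: an entry is `0` exactly when
it is minimal in its column. -/
noncomputable def pattern {m n : ℕ} (A : Matrix (Fin m) (Fin n) ℝ) :
    Matrix (Fin m) (Fin n) (WithTop ℝ) :=
  fun u v => if A u v = Finset.univ.inf' ⟨u, Finset.mem_univ u⟩ (fun i => A i v) then 0 else ⊤

open Classical in
/-- The support of the `j`-th column: the set of rows in which it has a `0`. -/
noncomputable def supp {m n : ℕ} (P : Matrix (Fin m) (Fin n) (WithTop ℝ)) (j : Fin n) :
    Finset (Fin m) :=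
  Finset.univ.filter (fun i => P i j = 0)

/-- The set of all column supports. -/
def supports {m n : ℕ} (P : Matrix (Fin m) (Fin n) (WithTop ℝ)) : Set (Finset (Fin m)) :=
  Set.range (supp P)

/-- A single equivalent transformation of a real matrix. -/
inductive Step {m n : ℕ} : Matrix (Fin m) (Fin n) ℝ → Matrix (Fin m) (Fin n) ℝ → Prop
  | permRows (A : Matrix (Fin m) (Fin n) ℝ) (σ : Equiv.Perm (Fin m)) : Step A (A.submatrix σ id)
  | permCols (A : Matrix (Fin m) (Fin n) ℝ) (τ : Equiv.Perm (Fin n)) : Step A (A.submatrix id τ)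
  | addRow (A : Matrix (Fin m) (Fin n) ℝ) (i : Fin m) (u : ℝ) :
      Step A (A.updateRow i (fun j => u + A i j))
  | addCol (A : Matrix (Fin m) (Fin n) ℝ) (j : Fin n) (u : ℝ) :
      Step A (A.updateCol j (fun i => u + A i j))

/-- Two matrices are equivalent if they can be obtained from each other by compositions of
equivalent transformations. -/
def TropEquiv {m n : ℕ} (A B : Matrix (Fin m) (Fin n) ℝ) : Prop :=
  Relation.ReflTransGen Step A B ∧ Relation.ReflTransGen Step B A

/-! The five configurations. Rows are indexed by `Fin 6 = {0, …, 5}`, so that the row called `k`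
in the usual numbering `1, …, 6` is `k - 1` here. -/

/-- The column supports are `{1,2}`, `{3,4}`, `{5,6}`. -/
def CaseI {n : ℕ} (P : Matrix (Fin 6) (Fin n) (WithTop ℝ)) : Prop :=
  supports P = {{0, 1}, {2, 3}, {4, 5}}

/-- The three-element subsets of `{3,4,5,6}`. -/
def triples3456 : Set (Finset (Fin 6)) :=
  {{3, 4, 5}, {2, 3, 5}, {2, 4, 5}, {2, 3, 4}}

/-- `{1,2}` is a support, some three-element subset of `{3,4,5,6}` is a support, and
every support is `{1,2}`, or a three-element subset of `{3,4,5,6}`, or `{3,4,5,6}`. -/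
def CaseII {n : ℕ} (P : Matrix (Fin 6) (Fin n) (WithTop ℝ)) : Prop :=
  {0, 1} ∈ supports P ∧
  (∃ T ∈ triples3456, T ∈ supports P) ∧
  ∀ T ∈ supports P, T = {0, 1} ∨ T ∈ triples3456 ∨ T = {2, 3, 4, 5}

/-- Every support is one of `{1,2,3}`, `{1,4,5}`, `{2,4,6}`, `{3,5,6}` or has at least four
elements, and no support is a proper subset of a four-element support. -/
def CaseIII {n : ℕ} (P : Matrix (Fin 6) (Fin n) (WithTop ℝ)) : Prop :=
  (∀ T ∈ supports P,
    T ∈ ({{0, 1, 2}, {0, 3, 4}, {1, 3, 5}, {2, 4, 5}} : Set (Finset (Fin 6))) ∨ 4 ≤ T.card) ∧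
  ∀ T ∈ supports P, T.card = 4 → ∀ T' ∈ supports P, ¬ T' ⊂ T

/-- `{1,2,3}` and `{4,5,6}` are supports, and every other support has at least two elements in
each of them. -/
def CaseIV {n : ℕ} (P : Matrix (Fin 6) (Fin n) (WithTop ℝ)) : Prop :=
  {0, 1, 2} ∈ supports P ∧ {3, 4, 5} ∈ supports P ∧
  ∀ T ∈ supports P, T ≠ {0, 1, 2} → T ≠ {3, 4, 5} →
    2 ≤ (T ∩ {0, 1, 2}).card ∧ 2 ≤ (T ∩ {3, 4, 5}).card

/-- The set of supports is `{{1,2}, {1,2,3}, {4,5,6}}`. -/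
def CaseV {n : ℕ} (P : Matrix (Fin 6) (Fin n) (WithTop ℝ)) : Prop :=
  supports P = {{0, 1}, {0, 1, 2}, {3, 4, 5}}

end Tropical3p1

namespace Tropical3p1

/-! For a row scaling `l`, each column is replaced by the set of rows where its minimum is attained.
These sets are the supports of the pattern, and the argument only manipulates them. The rank enters
through `NoTriangular`: a triangular 4 × 4 arrangement of supports, at any scaling, would make one
permutation the unique optimum. Its main consequence is `subset_of_two_disjoint`: if two distinct
supports avoid `S`, any support meeting `S` contains `S`. Lowering the rows of `S` slightly then
turns the supports meeting `S` into `S` and keeps all others (`exists_split`).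

A starting scaling whose supports cover all rows and have at least two elements comes from
`exists_shapley_le_or_lt`, an alternative for a min-max operator as in mean-payoff games. The other
branch makes each row the unique minimum of a column, which yields a diagonal 4 × 4 pattern.

Then unions of two distinct supports are compared. If some union is a triple `R`, the columns are
separated into those inside `R` and those equal to `Rᶜ`; if all unions have at least four elements
and a pair `P` occurs, they are separated into those equal to `P` and those inside `Pᶜ`; if all
supports have at least three elements, counting suffices. A separated system is handled by lowering
the complement of the block until it first touches a column inside the block. Either an earlier case
or a listed configuration appears, or the touched columns can be moved out of the block, and
induction on the number of columns left in the block applies (`hasSpecial_of_pair_split`,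
`hasSpecial_of_triple_split`). -/

/-! ### Supports under row scalings, and the rank condition -/

/-- The set of rows in which the `j`-th column of `A`, after adding `l` to the rows, is minimal. -/
noncomputable def argminSet {n : ℕ} (A : Matrix (Fin 6) (Fin n) ℝ) (l : Fin 6 → ℝ) (j : Fin n) :
    Finset (Fin 6) :=
  {i | ∀ k, A i j + l i ≤ A k j + l k}

lemma mem_argminSet {n : ℕ} {A : Matrix (Fin 6) (Fin n) ℝ} {l : Fin 6 → ℝ} {j : Fin n}
    {i : Fin 6} : i ∈ argminSet A l j ↔ ∀ k, A i j + l i ≤ A k j + l k := by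
  simp [argminSet]

lemma argminSet_nonempty {n : ℕ} (A : Matrix (Fin 6) (Fin n) ℝ) (l : Fin 6 → ℝ) (j : Fin n) :
    (argminSet A l j).Nonempty := by
  obtain ⟨i, hi⟩ := Finite.exists_min (fun i => A i j + l i)
  exact ⟨i, mem_argminSet.2 hi⟩

/-- Every row of `A`, after adding `l`, contains a minimal entry of some column. -/
def Covering {n : ℕ} (A : Matrix (Fin 6) (Fin n) ℝ) (l : Fin 6 → ℝ) : Prop :=
  ∀ i, ∃ j, i ∈ argminSet A l j

/-- No row scaling of `A` has a `4 × 4` submatrix whose pattern is triangular. -/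
def NoTriangular {n : ℕ} (A : Matrix (Fin 6) (Fin n) ℝ) : Prop :=
  ∀ (l : Fin 6 → ℝ) (r : Fin 4 → Fin 6) (c : Fin 4 → Fin n),
    (∀ k, r k ∈ argminSet A l (c k)) → ∃ k k', k < k' ∧ r k' ∈ argminSet A l (c k)

lemma perm_eq_one_of_le (σ : Equiv.Perm (Fin 4)) (h : ∀ k, k ≤ σ k) : σ = 1 := by
  revert σ; decide

/-- In a triangular arrangement the identity attains the sum of the column minima. Any permutation
`σ` of the same weight uses only minimal entries, so triangularity forces `k ≤ σ k` for all `k`,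
hence `σ = 1`, and the submatrix is nonsingular of size 4. -/
lemma noTriangular_of_tropRank {n : ℕ} {A : Matrix (Fin 6) (Fin n) ℝ} (ht : tropRank A = 3) :
    NoTriangular A := by
  intro l r c hr
  by_contra! hcon
  have hrinj : Function.Injective r := by
    intro a b hab
    by_contra hne
    rcases lt_or_gt_of_ne hne with h | h
    · exact hcon a b h (hab ▸ hr a)
    · exact hcon b a h (hab ▸ hr b)
  have hcinj : Function.Injective c := by
    intro a b hab
    by_contra hne
    rcases lt_or_gt_of_ne hne with h | h
    · exact hcon a b h (hab ▸ hr b)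
    · exact hcon b a h (hab ▸ hr a)
  set S := A.submatrix r c with hS
  have hid : ∀ σ : Equiv.Perm (Fin 4), permWeight S σ = tropPerm S → σ = 1 := by
    intro σ hσ
    have hle : permWeight S σ ≤ permWeight S 1 := by
      rw [hσ]; exact Finset.inf'_le _ (Finset.mem_univ _)
    have hterm : ∀ k, A (r (σ k)) (c (σ k)) + l (r (σ k)) ≤ A (r k) (c (σ k)) + l (r k) :=
      fun k => mem_argminSet.1 (hr (σ k)) (r k)
    have e1 : ∑ k, (A (r (σ k)) (c (σ k)) + l (r (σ k))) = ∑ k, (A (r k) (c k) + l (r k)) :=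
      Equiv.sum_comp σ (fun k => A (r k) (c k) + l (r k))
    have hsum : ∑ k, (A (r k) (c (σ k)) + l (r k))
        ≤ ∑ k, (A (r (σ k)) (c (σ k)) + l (r (σ k))) := by
      rw [e1, Finset.sum_add_distrib, Finset.sum_add_distrib]
      have : permWeight S σ ≤ permWeight S 1 := hle
      simp only [permWeight, hS, Matrix.submatrix_apply, Equiv.Perm.coe_one, id] at this
      linarith
    have heq := (Finset.sum_eq_sum_iff_of_le (fun k _ => hterm k)).1
      (le_antisymm (Finset.sum_le_sum fun k _ => hterm k) hsum)
    refine perm_eq_one_of_le σ fun k => ?_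
    by_contra hlt
    refine hcon (σ k) k (not_le.1 hlt) (mem_argminSet.2 fun i => ?_)
    rw [← heq k (Finset.mem_univ _)]
    exact mem_argminSet.1 (hr (σ k)) i
  have hns : ¬ IsTropSingular S := by
    rintro ⟨σ, τ, hne, h1, h2⟩
    exact hne ((hid σ h1).trans (hid τ h2).symm)
  have hbdd : BddAbove {r : ℕ | ∃ (f : Fin r ↪ Fin 6) (g : Fin r ↪ Fin n),
      ¬ IsTropSingular (A.submatrix f g)} := by
    refine ⟨6, ?_⟩
    rintro s ⟨f, -, -⟩
    simpa using Fintype.card_le_of_embedding f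
  have : 4 ≤ tropRank A := le_csSup hbdd ⟨⟨r, hrinj⟩, ⟨c, hcinj⟩, hns⟩
  omega

lemma columns_nonempty_of_tropRank {n : ℕ} {A : Matrix (Fin 6) (Fin n) ℝ} (ht : tropRank A = 3) :
    Nonempty (Fin n) := by
  by_contra hn
  have hset : {r : ℕ | ∃ (f : Fin r ↪ Fin 6) (g : Fin r ↪ Fin n),
      ¬ IsTropSingular (A.submatrix f g)} ⊆ {0} := by
    rintro s ⟨-, g, -⟩
    rcases Nat.eq_zero_or_pos s with h | h
    · exact h
    · exact absurd ⟨g ⟨0, h⟩⟩ hn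
  have : tropRank A ≤ 0 := by
    unfold tropRank
    rcases Set.subset_singleton_iff_eq.1 hset with h | h <;> simp [h]
  omega

/-! ### Lowering a set of rows -/

/-- Lowering the rows in `S` by `e`, where `e` does not exceed the height of the rows in `S` above
the minimum in those columns whose minimum is not attained in `S`. -/
lemma lower_rows {n : ℕ} (A : Matrix (Fin 6) (Fin n) ℝ) (l : Fin 6 → ℝ) (S : Finset (Fin 6))
    {e : ℝ} (he : 0 < e)
    (hle : ∀ j, Disjoint (argminSet A l j) S → ∀ i ∈ S, ∀ k ∈ argminSet A l j,
      e ≤ (A i j + l i) - (A k j + l k)) (j : Fin n) :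
    (¬ Disjoint (argminSet A l j) S →
      argminSet A (fun i => if i ∈ S then l i - e else l i) j = argminSet A l j ∩ S) ∧
    (Disjoint (argminSet A l j) S → ∀ i,
      i ∈ argminSet A (fun i => if i ∈ S then l i - e else l i) j ↔
        i ∈ argminSet A l j ∨
          i ∈ S ∧ ∃ k ∈ argminSet A l j, (A i j + l i) - (A k j + l k) = e) := by
  constructor
  · intro hd
    obtain ⟨p, hp, hpS⟩ := Finset.not_disjoint_iff.1 hd
    have hpm := mem_argminSet.1 hp
    ext i
    rw [Finset.mem_inter, mem_argminSet, mem_argminSet]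
    constructor
    · intro h
      have h1 := h p
      have h2 := hpm i
      by_cases hi : i ∈ S
      · simp only [hi, hpS, if_true] at h1
        exact ⟨fun k => by linarith [hpm k], hi⟩
      · simp only [hi, hpS, if_true, if_false] at h1
        linarith
    · rintro ⟨h, hi⟩ k
      have := h k
      by_cases hk : k ∈ S
      · simp only [hi, hk, if_true]; linarith
      · simp only [hi, hk, if_true, if_false]; linarith
  · intro hd i
    obtain ⟨p, hp⟩ := argminSet_nonempty A l j
    have hpS : p ∉ S := Finset.disjoint_left.1 hd hp
    have hpm := mem_argminSet.1 hp
    have hS := hle j hd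
    rw [mem_argminSet]
    constructor
    · intro h
      have h1 := h p
      by_cases hi : i ∈ S
      · right
        simp only [hi, hpS, if_true, if_false] at h1
        exact ⟨hi, p, hp, by linarith [hS i hi p hp]⟩
      · left
        simp only [hi, hpS, if_false] at h1
        exact mem_argminSet.2 fun k => by linarith [hpm k]
    · rintro (h | ⟨hi, k, hk, hik⟩) k'
      · have hi : i ∉ S := Finset.disjoint_left.1 hd h
        by_cases hk : k' ∈ S
        · simp only [hi, hk, if_true, if_false]; linarith [hS k' hk i h]
        · simp only [hi, hk, if_false]; linarith [mem_argminSet.1 h k']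
      · by_cases hk' : k' ∈ S
        · simp only [hi, hk', if_true]; linarith [hS k' hk' k hk]
        · simp only [hi, hk', if_true, if_false]; linarith [mem_argminSet.1 hk k']

/-- The least height of the rows in `S` above the minimum, over all columns whose minimum is not
attained in `S`. -/
lemma exists_least_height {n : ℕ} (A : Matrix (Fin 6) (Fin n) ℝ) (l : Fin 6 → ℝ)
    {S : Finset (Fin 6)} (hS : S.Nonempty) (hex : ∃ j, Disjoint (argminSet A l j) S) :
    ∃ e : ℝ, 0 < e ∧
      (∀ j, Disjoint (argminSet A l j) S → ∀ i ∈ S, ∀ k ∈ argminSet A l j,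
        e ≤ (A i j + l i) - (A k j + l k)) ∧
      ∃ j, Disjoint (argminSet A l j) S ∧ ∃ i ∈ S, ∃ k ∈ argminSet A l j,
        (A i j + l i) - (A k j + l k) = e := by
  classical
  set X : Finset (Fin n × Fin 6 × Fin 6) := {x | Disjoint (argminSet A l x.1) S ∧ x.2.1 ∈ S ∧
    x.2.2 ∈ argminSet A l x.1} with hX
  have hXne : X.Nonempty := by
    obtain ⟨j, hj⟩ := hex
    obtain ⟨i, hi⟩ := hS
    obtain ⟨k, hk⟩ := argminSet_nonempty A l j
    exact ⟨(j, i, k), by simp [hX, hj, hi, hk]⟩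
  obtain ⟨⟨j, i, k⟩, hx, hmin⟩ := Finset.exists_min_image X
    (fun x => (A x.2.1 x.1 + l x.2.1) - (A x.2.2 x.1 + l x.2.2)) hXne
  simp only [hX, Finset.mem_filter, Finset.mem_univ, true_and] at hx hmin
  refine ⟨_, ?_, fun j' hj' i' hi' k' hk' => hmin (j', i', k') ⟨hj', hi', hk'⟩,
    j, hx.1, i, hx.2.1, k, hx.2.2, rfl⟩
  by_contra hle
  refine Finset.disjoint_left.1 hx.1 (mem_argminSet.2 fun k' => ?_) hx.2.1
  linarith [mem_argminSet.1 hx.2.2 k']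

/-- Half the least height is too little for any column avoiding `S` to acquire a new minimal row. -/
lemma exists_lower_slightly {n : ℕ} (A : Matrix (Fin 6) (Fin n) ℝ) (l : Fin 6 → ℝ)
    (S : Finset (Fin 6)) : ∃ l', ∀ j,
      (¬ Disjoint (argminSet A l j) S → argminSet A l' j = argminSet A l j ∩ S) ∧
      (Disjoint (argminSet A l j) S → argminSet A l' j = argminSet A l j) := by
  rcases S.eq_empty_or_nonempty with rfl | hS
  · exact ⟨l, fun j => by simp⟩
  by_cases hex : ∃ j, Disjoint (argminSet A l j) S
  · obtain ⟨e, he, hle, -⟩ := exists_least_height A l hS hex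
    have hle' : ∀ j, Disjoint (argminSet A l j) S → ∀ i ∈ S, ∀ k ∈ argminSet A l j,
        e / 2 ≤ (A i j + l i) - (A k j + l k) := fun j hj i hi k hk => by
      linarith [hle j hj i hi k hk]
    refine ⟨_, fun j => ⟨(lower_rows A l S (half_pos he) hle' j).1, fun hj => ?_⟩⟩
    ext i
    rw [(lower_rows A l S (half_pos he) hle' j).2 hj i]
    refine ⟨?_, Or.inl⟩
    rintro (h | ⟨hi, k, hk, hik⟩)
    · exact h
    · linarith [hle j hj i hi k hk]
  -- Every column attains its minimum in `S`, so any positive amount works.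
  · push Not at hex
    exact ⟨_, fun j => ⟨(lower_rows A l S one_pos (fun j hj => absurd hj (hex j)) j).1,
      fun hj => absurd hj (hex j)⟩⟩

/-- Lowering by exactly the least height creates the first new minima: a column avoiding `S` keeps
its support and may gain rows of `S`, and at least one column does. -/
lemma exists_lower_until_contact {n : ℕ} (A : Matrix (Fin 6) (Fin n) ℝ) (l : Fin 6 → ℝ)
    {S : Finset (Fin 6)} (hS : S.Nonempty) (hex : ∃ j, Disjoint (argminSet A l j) S) :
    ∃ l', (∀ j,
      (¬ Disjoint (argminSet A l j) S → argminSet A l' j = argminSet A l j ∩ S) ∧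
      (Disjoint (argminSet A l j) S → argminSet A l' j = argminSet A l j ∨
        ∃ U ⊆ S, U.Nonempty ∧ argminSet A l' j = argminSet A l j ∪ U)) ∧
      ∃ j, Disjoint (argminSet A l j) S ∧ argminSet A l' j ≠ argminSet A l j := by
  obtain ⟨e, he, hle, j₀, hj₀, i₀, hi₀, k₀, hk₀, h₀⟩ := exists_least_height A l hS hex
  refine ⟨_, fun j => ⟨(lower_rows A l S he hle j).1, fun hj => ?_⟩, j₀, hj₀, fun h => ?_⟩
  · have hmem := (lower_rows A l S he hle j).2 hj
    set T' := argminSet A (fun i => if i ∈ S then l i - e else l i) j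
    have hT : T' = argminSet A l j ∪ T' ∩ S := by
      ext i
      have := hmem i
      simp only [Finset.mem_union, Finset.mem_inter]
      tauto
    rcases (T' ∩ S).eq_empty_or_nonempty with h | h
    · left; rw [h, Finset.union_empty] at hT; exact hT
    · exact Or.inr ⟨_, Finset.inter_subset_right, h, hT⟩
  · have := ((lower_rows A l S he hle j₀).2 hj₀ i₀).2 (Or.inr ⟨hi₀, k₀, hk₀, h₀⟩)
    rw [h] at this
    exact Finset.disjoint_left.1 hj₀ this hi₀

/-- If two distinct column supports avoid `S`, then each support meeting `S` contains `S`. -/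
lemma subset_of_two_disjoint {n : ℕ} {A : Matrix (Fin 6) (Fin n) ℝ} (hA : NoTriangular A)
    {l : Fin 6 → ℝ} (hcov : Covering A l) {S : Finset (Fin 6)} {j₁ j₂ : Fin n}
    (hne : argminSet A l j₁ ≠ argminSet A l j₂) (h₁ : Disjoint (argminSet A l j₁) S)
    (h₂ : Disjoint (argminSet A l j₂) S) {j : Fin n} (hj : ¬ Disjoint (argminSet A l j) S) :
    S ⊆ argminSet A l j := by
  wlog hsub : ¬ argminSet A l j₂ ⊆ argminSet A l j₁ generalizing j₁ j₂
  · exact this hne.symm h₂ h₁ fun h => hne (h.antisymm (not_not.1 hsub))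
  obtain ⟨a, ha₂, ha₁⟩ := Finset.not_subset.1 hsub
  obtain ⟨b, hb⟩ := argminSet_nonempty A l j₁
  obtain ⟨p, hp, hpS⟩ := Finset.not_disjoint_iff.1 hj
  intro s hs
  by_contra hsj
  obtain ⟨j', hj'⟩ := hcov s
  -- Rows `b, a, p, s` and columns `j₁, j₂, j, j'` are triangular: `a` is outside the first support,
  -- `p` and `s` lie in `S` and so outside the first two, and `s` is outside the third.
  obtain ⟨k, k', hlt, hk⟩ := hA l ![b, a, p, s] ![j₁, j₂, j, j'] (by
    intro k; fin_cases k <;> simpa)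
  have n1 := fun h => Finset.disjoint_left.1 h₁ h hpS
  have n2 := fun h => Finset.disjoint_left.1 h₁ h hs
  have n3 := fun h => Finset.disjoint_left.1 h₂ h hpS
  have n4 := fun h => Finset.disjoint_left.1 h₂ h hs
  fin_cases k <;> fin_cases k' <;> simp_all

/-! ### A scaling with every column minimum attained twice -/

lemma compl_singleton_nonempty (i : Fin 6) : ({i}ᶜ : Finset (Fin 6)).Nonempty :=
  ⟨i + 1, by simp⟩

/-- The operator whose post-fixed points `l`, i.e. those with `shapley A l ≤ l`, are the row
scalings for which every column minimum is attained at least twice. -/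
noncomputable def shapley {n : ℕ} [Nonempty (Fin n)] (A : Matrix (Fin 6) (Fin n) ℝ)
    (l : Fin 6 → ℝ) (i : Fin 6) : ℝ :=
  Finset.univ.sup' Finset.univ_nonempty fun j =>
    ({i}ᶜ : Finset (Fin 6)).inf' (compl_singleton_nonempty i) (fun k => A k j + l k) - A i j

lemma shapley_le_iff {n : ℕ} [Nonempty (Fin n)] {A : Matrix (Fin 6) (Fin n) ℝ} {l : Fin 6 → ℝ}
    {i : Fin 6} {x : ℝ} :
    shapley A l i ≤ x ↔ ∀ j, ∃ k, k ≠ i ∧ A k j + l k ≤ x + A i j := by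
  simp only [shapley, Finset.sup'_le_iff, Finset.mem_univ, true_implies, sub_le_iff_le_add]
  refine forall_congr' fun j => ?_
  rw [Finset.inf'_le_iff]
  simp

lemma lt_shapley_iff {n : ℕ} [Nonempty (Fin n)] {A : Matrix (Fin 6) (Fin n) ℝ} {l : Fin 6 → ℝ}
    {i : Fin 6} {x : ℝ} :
    x < shapley A l i ↔ ∃ j, ∀ k, k ≠ i → x + A i j < A k j + l k := by
  rw [← not_le, shapley_le_iff]
  push Not
  rfl

/-- Minima over rows and maxima over columns are nonexpansive in the sup norm. -/
lemma lipschitzWith_shapley {n : ℕ} [Nonempty (Fin n)] (A : Matrix (Fin 6) (Fin n) ℝ) :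
    LipschitzWith 1 (shapley A) := by
  have key : ∀ l m i, shapley A l i ≤ shapley A m i + dist l m := fun l m i => by
    rw [shapley_le_iff]
    intro j
    obtain ⟨k, hk, h⟩ := shapley_le_iff.1 (le_refl (shapley A m i)) j
    refine ⟨k, hk, ?_⟩
    have := (le_abs_self _).trans ((Real.dist_eq _ _).symm.le.trans (dist_le_pi_dist l m k))
    linarith
  refine LipschitzWith.of_dist_le_mul fun l m => ?_
  rw [NNReal.coe_one, one_mul, dist_pi_le_iff dist_nonneg]
  intro i
  rw [Real.dist_eq, abs_le]
  have h1 := key l m i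
  have h2 := key m l i
  rw [dist_comm m l] at h2
  constructor <;> linarith

/-- The factor `a < 1` makes the nonexpansive operator a contraction. The undiscounted operator need
not have a fixed point, so `a` is later taken close to 1. -/
lemma exists_discounted_fixedPoint {n : ℕ} [Nonempty (Fin n)] (A : Matrix (Fin 6) (Fin n) ℝ)
    {a : ℝ} (ha₀ : 0 < a) (ha₁ : a < 1) : ∃ m, ∀ i, a * shapley A m i = m i := by
  have hc : ContractingWith ⟨a, ha₀.le⟩ (fun l => a • shapley A l) := by
    refine ⟨by exact_mod_cast ha₁, LipschitzWith.of_dist_le_mul fun l m => ?_⟩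
    rw [dist_smul₀, Real.norm_of_nonneg ha₀.le]
    have := (lipschitzWith_shapley A).dist_le_mul l m
    simp only [NNReal.coe_one, one_mul] at this
    exact mul_le_mul_of_nonneg_left this ha₀.le
  exact ⟨_, fun i => congrFun hc.fixedPoint_isFixedPt i⟩

/-- Either some row scaling has every row as the unique minimum of a column, or some row scaling has
every column minimum attained at least twice. -/
lemma exists_shapley_le_or_lt {n : ℕ} [Nonempty (Fin n)] (A : Matrix (Fin 6) (Fin n) ℝ) :
    (∃ l, ∀ i, l i < shapley A l i) ∨ ∃ l, ∀ i, shapley A l i ≤ l i := by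
  by_contra! hcon
  obtain ⟨hlt, hle⟩ := hcon
  obtain ⟨C, hC⟩ : ∃ C, ∀ i k j, A k j - A i j ≤ C := by
    obtain ⟨x, hx⟩ := Finite.exists_max
      (fun x : Fin 6 × Fin 6 × Fin n => A x.2.1 x.2.2 - A x.1 x.2.2)
    exact ⟨_, fun i k j => hx (i, k, j)⟩
  have hC0 : 0 ≤ C := by
    obtain ⟨j⟩ := ‹Nonempty (Fin n)›
    simpa using hC 0 0 j
  -- The box does not depend on `a`. At a discounted fixed point, `hle` gives a positive coordinate
  -- and `hlt` a nonpositive one; comparison with the smallest coordinate bounds the rest.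
  have hbox : ∀ a : ℝ, 0 < a → a < 1 → ∃ m ∈ Set.Icc (fun _ : Fin 6 => -C) (fun _ => C),
      ∀ i, a * shapley A m i = m i := by
    intro a ha₀ ha₁
    obtain ⟨m, hm⟩ := exists_discounted_fixedPoint A ha₀ ha₁
    obtain ⟨p, hp⟩ := Finite.exists_min m
    obtain ⟨q, hq⟩ := hle m
    obtain ⟨q', hq'⟩ := hlt m
    have hup : ∀ i, i ≠ p → shapley A m i ≤ m p + C := fun i hi =>
      shapley_le_iff.2 fun j => ⟨p, hi.symm, by linarith [hC i p j]⟩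
    have hqpos : 0 < m q := by
      have := hm q
      by_contra hneg
      nlinarith
    have hq'neg : m q' ≤ 0 := by
      have := hm q'
      by_contra hpos
      nlinarith
    have hp0 : m p ≤ 0 := (hp q').trans hq'neg
    have hqp : q ≠ p := by rintro rfl; linarith
    have hpC : -C ≤ m p := by
      have h1 := hup q hqp
      have h2 := hm q
      by_contra hneg
      have : shapley A m q < 0 := by linarith
      nlinarith
    refine ⟨m, ⟨fun i => hpC.trans (hp i), fun i => ?_⟩, hm⟩
    by_cases hi : i = p
    · subst hi; exact hp0.trans hC0
    · have h1 := hup i hi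
      have h2 := hm i
      change m i ≤ C
      rw [← h2]
      by_cases h3 : 0 ≤ shapley A m i
      · nlinarith
      · nlinarith
  -- By `hle` the largest excess of `shapley A m` over `m` is positive everywhere, so on the compact
  -- box it has a positive minimum `c`.
  have hcont : Continuous fun m : Fin 6 → ℝ =>
      Finset.univ.sup' Finset.univ_nonempty fun i => shapley A m i - m i := by
    refine Continuous.finset_sup'_apply _ fun i _ => ?_
    exact ((continuous_apply i).comp (lipschitzWith_shapley A).continuous).sub (continuous_apply i)
  obtain ⟨m₀, -, hmin⟩ := (isCompact_Icc (a := fun _ : Fin 6 => -C) (b := fun _ => C)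
    ).exists_isMinOn ⟨fun _ => 0, fun _ => by simpa, fun _ => hC0⟩ hcont.continuousOn
  set c := Finset.univ.sup' Finset.univ_nonempty fun i => shapley A m₀ i - m₀ i with hc
  have hcpos : 0 < c := by
    obtain ⟨i, hi⟩ := hle m₀
    exact (sub_pos.2 hi).trans_le
      (Finset.le_sup' (fun i => shapley A m₀ i - m₀ i) (Finset.mem_univ i))
  have hD : 0 < 2 * C + c := by linarith
  -- At the fixed point the excess is `(1 - a) * shapley A m i`. Since `a ≥ 1/2`, the second factor
  -- is at most `2 * C`, and this `a` makes `(1 - a) * (2 * C) < c`.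
  set a := 1 - c / (2 * (2 * C + c)) with ha
  have hr : c / (2 * (2 * C + c)) * (2 * (2 * C + c)) = c := by field_simp
  set r := c / (2 * (2 * C + c)) with hrdef
  have hr0 : 0 < r := by positivity
  have hr2 : r ≤ 1 / 2 := by
    rw [hrdef, div_le_iff₀ (by positivity)]; linarith
  obtain ⟨m, hm, hfix⟩ := hbox a (by linarith) (by linarith)
  have hcm : c ≤ Finset.univ.sup' Finset.univ_nonempty fun i => shapley A m i - m i := hmin hm
  obtain ⟨i, -, hi⟩ := Finset.exists_mem_eq_sup' Finset.univ_nonempty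
    (fun i => shapley A m i - m i)
  rw [hi] at hcm
  have h1 := hfix i
  have h2 : m i ≤ C := hm.2 i
  have h3 : shapley A m i ≤ 2 * C := by
    by_contra hneg
    have : shapley A m i * (1 / 2) ≤ shapley A m i * a :=
      mul_le_mul_of_nonneg_left (by linarith) (by linarith)
    linarith
  have h4 : shapley A m i - m i = r * shapley A m i := by rw [← h1, ha]; ring
  have h5 : r * shapley A m i ≤ r * (2 * C) := mul_le_mul_of_nonneg_left h3 hr0.le
  nlinarith

/-- A matrix of tropical rank at most `3` has a row scaling with every column minimum attained at
least twice and every row containing a column minimum. -/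
lemma exists_covering_two_le_card {n : ℕ} [Nonempty (Fin n)] {A : Matrix (Fin 6) (Fin n) ℝ}
    (hA : NoTriangular A) : ∃ l, Covering A l ∧ ∀ j, 2 ≤ (argminSet A l j).card := by
  rcases exists_shapley_le_or_lt A with ⟨l, hl⟩ | ⟨l, hl⟩
  · exfalso
    choose c hc using fun i => lt_shapley_iff.1 (hl i)
    -- The first four rows, each with a column where it is the strict minimum, form a diagonal
    -- pattern.
    obtain ⟨k, k', hkk, hk⟩ := hA l (Fin.castLE (by norm_num))
      (fun k => c (Fin.castLE (by norm_num) k)) (fun k => mem_argminSet.2 fun i => by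
        by_cases hi : i = Fin.castLE (by norm_num) k
        · rw [hi]
        · linarith [hc _ i hi])
    have h1 := hc (Fin.castLE (by norm_num) k) (Fin.castLE (by norm_num) k')
      (fun h => hkk.ne' (Fin.castLE_injective _ h))
    have h2 := mem_argminSet.1 hk (Fin.castLE (by norm_num) k)
    linarith
  · choose p hp using fun j => argminSet_nonempty A l j
    have hpm := fun j => mem_argminSet.1 (hp j)
    choose q hq using fun i => Finite.exists_min fun j => A i j + l i - (A (p j) j + l (p j))
    -- Each row drops by its least height above the column minima. The minima stay the same, rows
    -- already touching a minimum do not move, and row `i` now touches in column `q i`.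
    set l' : Fin 6 → ℝ := fun i => l i - (A i (q i) + l i - (A (p (q i)) (q i) + l (p (q i))))
      with hl'
    have hlow : ∀ i j, A (p j) j + l (p j) ≤ A i j + l' i := fun i j => by
      have := hq i j
      simp only [hl']
      linarith
    have hle : ∀ i, l' i ≤ l i := fun i => by
      have := hpm (q i) i
      simp only [hl']
      linarith
    refine ⟨l', fun i => ⟨q i, mem_argminSet.2 fun k => ?_⟩, fun j => ?_⟩
    · refine le_trans (le_of_eq ?_) (hlow k (q i))
      simp only [hl']
      ring
    · obtain ⟨k, hk, hkp⟩ := shapley_le_iff.1 (hl (p j)) j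
      refine Finset.one_lt_card.2 ⟨p j, mem_argminSet.2 fun i => ?_, k,
        mem_argminSet.2 fun i => ?_, hk.symm⟩
      · linarith [hlow i j, hle (p j)]
      · linarith [hlow i j, hle k]

/-! ### Reduction to the special configurations -/

/-- The configurations of the theorem, for a family of column supports and up to a permutation of
the rows. -/
inductive IsSpecial {n : ℕ} (F : Fin n → Finset (Fin 6)) : Prop
  | threePairs (P Q : Finset (Fin 6)) (hP : P.card = 2) (hQ : Q.card = 2) (hPQ : Disjoint P Q)
      (h₁ : ∃ j, F j = P) (h₂ : ∃ j, F j = Q) (h₃ : ∃ j, F j = (P ∪ Q)ᶜ)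
      (h : ∀ j, F j = P ∨ F j = Q ∨ F j = (P ∪ Q)ᶜ)
  | pairTriples (P : Finset (Fin 6)) (hP : P.card = 2) (h₁ : ∃ j, F j = P)
      (h₂ : ∃ j, (F j).card = 3) (h : ∀ j, F j = P ∨ F j ⊆ Pᶜ ∧ 3 ≤ (F j).card)
  | quadrilateral (h₁ : ∀ j, 3 ≤ (F j).card)
      (h₂ : ∀ j j', (F j).card = 3 → (F j').card = 3 → F j ≠ F j' → (F j ∩ F j').card = 1)
      (h₃ : ∀ j j', (F j).card = 4 → ¬ F j' ⊂ F j)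
  | disjointTriples (R : Finset (Fin 6)) (hR : R.card = 3) (h₁ : ∃ j, F j = R)
      (h₂ : ∃ j, F j = Rᶜ)
      (h : ∀ j, F j ≠ R → F j ≠ Rᶜ → 2 ≤ (F j ∩ R).card ∧ 2 ≤ (F j ∩ Rᶜ).card)
  | flag (P R : Finset (Fin 6)) (hP : P.card = 2) (hR : R.card = 3) (hPR : P ⊆ R)
      (h₁ : ∃ j, F j = P) (h₂ : ∃ j, F j = R) (h₃ : ∃ j, F j = Rᶜ)
      (h : ∀ j, F j = P ∨ F j = R ∨ F j = Rᶜ)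

/-- Some row scaling of `A` covers all rows and has one of the special configurations. -/
def HasSpecial {n : ℕ} (A : Matrix (Fin 6) (Fin n) ℝ) : Prop :=
  ∃ l, Covering A l ∧ IsSpecial (argminSet A l)

lemma card_compl_fin_six (S : Finset (Fin 6)) : Sᶜ.card + S.card = 6 := by
  simp [S.card_compl_add_card]

lemma disjoint_compl_iff_subset {S T : Finset (Fin 6)} : Disjoint T Sᶜ ↔ T ⊆ S := by
  rw [← le_compl_iff_disjoint_right, compl_compl]

lemma lt_card_union {S T : Finset (Fin 6)} {k : ℕ} (hne : S ≠ T) (hS : k ≤ S.card)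
    (hT : k ≤ T.card) : k < (S ∪ T).card := by
  by_contra! h
  exact hne ((Finset.eq_of_subset_of_card_le Finset.subset_union_left (h.trans hS)).trans
    (Finset.eq_of_subset_of_card_le Finset.subset_union_right (h.trans hT)).symm)

/-- If two distinct supports avoid `S`, one may shrink to `S` all supports that meet `S`. -/
lemma exists_split {n : ℕ} {A : Matrix (Fin 6) (Fin n) ℝ} (hA : NoTriangular A)
    {l : Fin 6 → ℝ} (hcov : Covering A l) {S : Finset (Fin 6)} (hS : S.Nonempty) {j₁ j₂ : Fin n}
    (hne : argminSet A l j₁ ≠ argminSet A l j₂) (h₁ : Disjoint (argminSet A l j₁) S)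
    (h₂ : Disjoint (argminSet A l j₂) S) :
    ∃ l', (∃ j, argminSet A l' j = S) ∧ ∀ j,
      (¬ Disjoint (argminSet A l j) S ∧ argminSet A l' j = S) ∨
      (Disjoint (argminSet A l j) S ∧ argminSet A l' j = argminSet A l j) := by
  obtain ⟨l', hl'⟩ := exists_lower_slightly A l S
  have hall : ∀ j, ¬ Disjoint (argminSet A l j) S → argminSet A l' j = S := fun j hj => by
    rw [(hl' j).1 hj, Finset.inter_eq_right]
    exact subset_of_two_disjoint hA hcov hne h₁ h₂ hj
  refine ⟨l', ?_, fun j => ?_⟩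
  · obtain ⟨s, hs⟩ := hS
    obtain ⟨j, hj⟩ := hcov s
    exact ⟨j, hall j (Finset.not_disjoint_iff.2 ⟨s, hj, hs⟩)⟩
  · by_cases hj : Disjoint (argminSet A l j) S
    · exact Or.inr ⟨hj, (hl' j).2 hj⟩
    · exact Or.inl ⟨hj, hall j hj⟩

lemma covering_of_union {n : ℕ} {A : Matrix (Fin 6) (Fin n) ℝ} {l : Fin 6 → ℝ}
    {S : Finset (Fin 6)} (h : ∀ i ∈ S, ∃ j, i ∈ argminSet A l j)
    (h' : ∃ j, argminSet A l j = Sᶜ) : Covering A l := by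
  intro i
  by_cases hi : i ∈ S
  · exact h i hi
  · obtain ⟨j, hj⟩ := h'
    exact ⟨j, by simpa [hj] using hi⟩

/-- If two distinct supports have a union of at most four elements, the union has exactly four and
one of them is a triple; splitting off the remaining pair gives `pairTriples`. Otherwise distinct
unions have at least five elements. When `R` and `Rᶜ` are triples among the supports, `|T ∪ Rᶜ| = 3
+ |T ∩ R|` gives the bounds of `disjointTriples`; when no such triples occur, two distinct triples
meet in exactly one point. -/
lemma hasSpecial_of_three_le_card {n : ℕ} {A : Matrix (Fin 6) (Fin n) ℝ} (hA : NoTriangular A)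
    {l : Fin 6 → ℝ} (hcov : Covering A l) (h3 : ∀ j, 3 ≤ (argminSet A l j).card) :
    HasSpecial A := by
  by_cases hex : ∃ j₁ j₂, argminSet A l j₁ ≠ argminSet A l j₂ ∧
      (argminSet A l j₁ ∪ argminSet A l j₂).card ≤ 4
  · obtain ⟨j₁, j₂, hne, hcard⟩ := hex
    set T₁ := argminSet A l j₁ with hT₁
    set T₂ := argminSet A l j₂ with hT₂
    have hs₁ : T₁ ⊆ T₁ ∪ T₂ := Finset.subset_union_left
    have hs₂ : T₂ ⊆ T₁ ∪ T₂ := Finset.subset_union_right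
    have h3₁ : 3 ≤ T₁.card := h3 j₁
    have h3₂ : 3 ≤ T₂.card := h3 j₂
    have hor : T₁.card = 3 ∨ T₂.card = 3 := by
      by_contra! h
      have := lt_card_union hne (k := 4) (by omega) (by omega)
      omega
    have hU : (T₁ ∪ T₂).card = 4 := by
      have := lt_card_union hne h3₁ h3₂
      omega
    have hSc := card_compl_fin_six (T₁ ∪ T₂)
    obtain ⟨l', hS, hl'⟩ := exists_split hA hcov (S := (T₁ ∪ T₂)ᶜ)
      (Finset.card_pos.1 (by omega)) hne (disjoint_compl_iff_subset.2 hs₁)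
      (disjoint_compl_iff_subset.2 hs₂)
    have hk : ∀ j, argminSet A l j ⊆ T₁ ∪ T₂ → argminSet A l' j = argminSet A l j := fun j hj =>
      (hl' j).elim (fun h => absurd (disjoint_compl_iff_subset.2 hj) h.1) (fun h => h.2)
    refine ⟨l', covering_of_union (S := T₁ ∪ T₂) (fun i hi => ?_) hS,
      .pairTriples (T₁ ∪ T₂)ᶜ (by omega) hS ?_ fun j => ?_⟩
    · rcases Finset.mem_union.1 hi with h | h
      · exact ⟨j₁, by rwa [hk j₁ hs₁]⟩
      · exact ⟨j₂, by rwa [hk j₂ hs₂]⟩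
    · rcases hor with h | h
      · exact ⟨j₁, by rwa [hk j₁ hs₁]⟩
      · exact ⟨j₂, by rwa [hk j₂ hs₂]⟩
    · rcases hl' j with h | h
      · exact Or.inl h.2
      · right
        rw [h.2, compl_compl]
        exact ⟨disjoint_compl_iff_subset.1 h.1, h3 j⟩
  · push Not at hex
    by_cases hdis : ∃ j₁ j₂, (argminSet A l j₁).card = 3 ∧ argminSet A l j₂ = (argminSet A l j₁)ᶜ
    · obtain ⟨j₁, j₂, hR, hj₂⟩ := hdis
      refine ⟨l, hcov, .disjointTriples (argminSet A l j₁) hR ⟨j₁, rfl⟩ ⟨j₂, hj₂⟩ fun j hj hj' => ?_⟩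
      have u1 := hex j j₁ hj
      have u2 := hex j j₂ (by rwa [hj₂])
      have c1 := Finset.card_union_add_card_inter (argminSet A l j) (argminSet A l j₁)
      have c2 := Finset.card_union_add_card_inter (argminSet A l j) (argminSet A l j₂)
      have c3 := Finset.card_inter_add_card_sdiff (argminSet A l j) (argminSet A l j₁)
      have c4 := card_compl_fin_six (argminSet A l j₁)
      rw [Finset.sdiff_eq_inter_compl, ← hj₂] at c3
      rw [← hj₂] at c4 ⊢
      omega
    · push Not at hdis
      refine ⟨l, hcov, .quadrilateral h3 (fun j j' hj hj' hne => ?_) fun j j' hj hss => ?_⟩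
      · have u := hex j j' hne
        have c := Finset.card_union_add_card_inter (argminSet A l j) (argminSet A l j')
        have c' : (argminSet A l j ∩ argminSet A l j').card ≠ 0 := fun h0 => by
          have hd := Finset.disjoint_iff_inter_eq_empty.2 (Finset.card_eq_zero.1 h0)
          refine hdis j j' hj (Finset.eq_of_subset_of_card_le ?_ ?_)
          · exact le_compl_iff_disjoint_left.2 hd
          · have := card_compl_fin_six (argminSet A l j); omega
        omega
      · have u := hex j' j hss.ne
        rw [Finset.union_eq_right.2 hss.subset] at u
        omega

/-- Induction on the number `N` of columns with support `P`. Another pair or a triple in `Pᶜ`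
finishes at once; otherwise only `P` and `Pᶜ` occur, and `Pᶜ` is lowered until contact. -/
lemma hasSpecial_of_pair_split {n : ℕ} {A : Matrix (Fin 6) (Fin n) ℝ} (hA : NoTriangular A)
    {P : Finset (Fin 6)} (hP : P.card = 2) (N : ℕ) :
    ∀ l : Fin 6 → ℝ, Covering A l →
      (∀ j, argminSet A l j = P ∨ argminSet A l j ⊆ Pᶜ ∧ 2 ≤ (argminSet A l j).card) →
      (Finset.univ.filter fun j => argminSet A l j = P).card = N →
      HasSpecial A := by
  have hPne : P.Nonempty := Finset.card_pos.1 (by omega)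
  have hPc := card_compl_fin_six P
  induction N using Nat.strong_induction_on with
  | _ N ih =>
  intro l hcov hall hN
  obtain ⟨jP, hjP⟩ : ∃ j, argminSet A l j = P := by
    obtain ⟨p, hp⟩ := hPne
    obtain ⟨j, hj⟩ := hcov p
    rcases hall j with h | h
    · exact ⟨j, h⟩
    · exact absurd hp (Finset.mem_compl.1 (h.1 hj))
  have hneP : ∀ {T : Finset (Fin 6)}, T ⊆ Pᶜ → T ≠ P := by
    rintro T hT rfl
    obtain ⟨p, hp⟩ := hPne
    exact Finset.mem_compl.1 (hT hp) hp
  by_cases hpair : ∃ j, argminSet A l j ⊆ Pᶜ ∧ (argminSet A l j).card = 2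
  · obtain ⟨jQ, hQ, hQ2⟩ := hpair
    set Q := argminSet A l jQ with hQdef
    have hdis : Disjoint P Q := (Finset.subset_compl_iff_disjoint_left).1 hQ
    have hcard := Finset.card_union_of_disjoint hdis
    have hSc := card_compl_fin_six (P ∪ Q)
    obtain ⟨l', hS, hl'⟩ := exists_split hA hcov (S := (P ∪ Q)ᶜ)
      (Finset.card_pos.1 (by omega)) (j₁ := jP) (j₂ := jQ) (by rw [hjP]; exact (hneP hQ).symm)
      (disjoint_compl_iff_subset.2 (by rw [hjP]; exact Finset.subset_union_left))
      (disjoint_compl_iff_subset.2 Finset.subset_union_right)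
    have hk : ∀ j, argminSet A l j ⊆ P ∪ Q → argminSet A l' j = argminSet A l j := fun j hj =>
      (hl' j).elim (fun h => absurd (disjoint_compl_iff_subset.2 hj) h.1) (fun h => h.2)
    have hP' : argminSet A l' jP = P := by
      rw [hk jP (by rw [hjP]; exact Finset.subset_union_left), hjP]
    have hQ' : argminSet A l' jQ = Q := hk jQ Finset.subset_union_right
    refine ⟨l', covering_of_union (S := P ∪ Q) (fun i hi => ?_) hS,
      .threePairs P Q hP hQ2 hdis ⟨jP, hP'⟩ ⟨jQ, hQ'⟩ hS fun j => ?_⟩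
    · rcases Finset.mem_union.1 hi with h | h
      · exact ⟨jP, by rwa [hP']⟩
      · exact ⟨jQ, by rwa [hQ']⟩
    · rcases hl' j with h | h
      · exact Or.inr (Or.inr h.2)
      · rw [h.2]
        rcases hall j with h1 | ⟨h1, h2⟩
        · exact Or.inl h1
        · refine Or.inr (Or.inl (Finset.eq_of_subset_of_card_le (fun i hi => ?_) (by omega)))
          exact (Finset.mem_union.1 (disjoint_compl_iff_subset.1 h.1 hi)).resolve_left
            (Finset.mem_compl.1 (h1 hi))
  by_cases htriple : ∃ j, (argminSet A l j).card = 3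
  · refine ⟨l, hcov, .pairTriples P hP ⟨jP, hjP⟩ htriple fun j => (hall j).imp_right fun h =>
      ⟨h.1, ?_⟩⟩
    by_contra hlt
    exact hpair ⟨j, h.1, by omega⟩
  have hall' : ∀ j, argminSet A l j = P ∨ argminSet A l j = Pᶜ := fun j =>
    (hall j).imp_right fun h => Finset.eq_of_subset_of_card_le h.1 (by
      by_contra hlt
      have h2 : (argminSet A l j).card ≠ 2 := fun h2 => hpair ⟨j, h.1, h2⟩
      have h3 : (argminSet A l j).card ≠ 3 := fun h3 => htriple ⟨j, h3⟩
      omega)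
  obtain ⟨jc, hjc⟩ : ∃ j, argminSet A l j = Pᶜ := by
    obtain ⟨p, hp⟩ := Finset.card_pos.1 (show 0 < Pᶜ.card by omega)
    obtain ⟨j, hj⟩ := hcov p
    rcases hall' j with h | h
    · exact absurd (h ▸ hj) (Finset.mem_compl.1 hp)
    · exact ⟨j, h⟩
  have hPd : Disjoint P Pᶜ := disjoint_compl_right
  have hcP : ¬ Pᶜ ⊆ P := fun h => by
    have := Finset.card_le_card h
    omega
  obtain ⟨l', hl', jn, hjn, hjn'⟩ := exists_lower_until_contact A l (S := Pᶜ)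
    (Finset.card_pos.1 (by omega)) ⟨jP, by rw [hjP]; exact hPd⟩
  have hc' : ∀ j, argminSet A l j = Pᶜ → argminSet A l' j = Pᶜ := fun j hj => by
    rw [(hl' j).1 (by rw [disjoint_compl_iff_subset, hj]; exact hcP), hj, Finset.inter_self]
  have hp' : ∀ j, argminSet A l j = P → argminSet A l' j = P ∨
      ∃ U ⊆ Pᶜ, U.Nonempty ∧ argminSet A l' j = P ∪ U := fun j hj => by
    have := (hl' j).2 (by rw [hj]; exact hPd)
    rwa [hj] at this
  have hsub : ∀ j, argminSet A l j = P → P ⊆ argminSet A l' j := fun j hj => by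
    rcases hp' j hj with h | ⟨U, -, -, h⟩ <;> rw [h]
    exact Finset.subset_union_left
  have hcov' : Covering A l' :=
    covering_of_union (S := P) (fun i hi => ⟨jP, hsub jP hjP hi⟩) ⟨jc, hc' jc hjc⟩
  have hjnP : argminSet A l jn = P := (hall' jn).resolve_right fun h => by
    rw [h, disjoint_compl_iff_subset] at hjn
    exact hcP hjn
  by_cases hgone : ∀ j, argminSet A l' j ≠ P
  · refine hasSpecial_of_three_le_card hA hcov' fun j => ?_
    rcases hall' j with h | h
    · have h1 := Finset.card_lt_card ((hsub j h).ssubset_of_ne (hgone j).symm)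
      omega
    · rw [hc' j h]; omega
  push Not at hgone
  obtain ⟨j₀, hj₀⟩ := hgone
  -- A column that gained a single row has a triple `R ⊃ P` as support. With the column still equal
  -- to `P` it provides two distinct supports avoiding `Rᶜ`, so splitting gives a flag.
  by_cases hone : ∃ j, argminSet A l j = P ∧ (argminSet A l' j).card = 3
  · obtain ⟨j₁, hj₁, hR⟩ := hone
    have hPR := hsub j₁ hj₁
    set R := argminSet A l' j₁ with hRdef
    have hRc := card_compl_fin_six R
    obtain ⟨l'', hS, hl''⟩ := exists_split hA hcov' (S := Rᶜ) (Finset.card_pos.1 (by omega))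
      (j₁ := j₀) (j₂ := j₁) (by rw [hj₀]; intro h; have : P.card = R.card := congrArg _ h; omega)
      (disjoint_compl_iff_subset.2 (by rw [hj₀]; exact hPR))
      (disjoint_compl_iff_subset.2 subset_rfl)
    have hk : ∀ j, argminSet A l' j ⊆ R → argminSet A l'' j = argminSet A l' j := fun j hj =>
      (hl'' j).elim (fun h => absurd (disjoint_compl_iff_subset.2 hj) h.1) (fun h => h.2)
    have hR' : argminSet A l'' j₁ = R := hk j₁ subset_rfl
    refine ⟨l'', covering_of_union (S := R) (fun i hi => ⟨j₁, by rwa [hR']⟩) hS,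
      .flag P R hP hR hPR ⟨j₀, by rw [hk j₀ (by rwa [hj₀]), hj₀]⟩ ⟨j₁, hR'⟩ hS fun j => ?_⟩
    rcases hl'' j with h | h
    · exact Or.inr (Or.inr h.2)
    · have hjR := disjoint_compl_iff_subset.1 h.1
      rw [h.2]
      rcases hall' j with h1 | h1
      · by_cases he : argminSet A l' j = P
        · exact Or.inl he
        · refine Or.inr (Or.inl (Finset.eq_of_subset_of_card_le hjR ?_))
          have := Finset.card_lt_card ((hsub j h1).ssubset_of_ne (Ne.symm he))
          omega
      · rw [hc' j h1] at hjR
        have := Finset.card_le_card hjR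
        omega
  · push Not at hone
    -- Every touched column gained at least two rows. Lowering `Pᶜ` a little more leaves it exactly
    -- those rows, so it moves into `Pᶜ` and `N` drops.
    obtain ⟨l'', hl''⟩ := exists_lower_slightly A l' Pᶜ
    have hc'' : ∀ j, argminSet A l j = Pᶜ → argminSet A l'' j = Pᶜ := fun j hj => by
      rw [(hl'' j).1 (by rw [disjoint_compl_iff_subset, hc' j hj]; exact hcP), hc' j hj,
        Finset.inter_self]
    have hp'' : ∀ j, argminSet A l' j = P → argminSet A l'' j = P := fun j hj => by
      rw [(hl'' j).2 (by rw [hj]; exact hPd), hj]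
    have hu'' : ∀ j, argminSet A l j = P → argminSet A l' j ≠ P →
        argminSet A l'' j ⊆ Pᶜ ∧ 2 ≤ (argminSet A l'' j).card := fun j hj hne => by
      have hss := (hsub j hj).ssubset_of_ne (Ne.symm hne)
      rw [(hl'' j).1 (fun h => hne (((disjoint_compl_iff_subset).1 h).antisymm (hsub j hj)))]
      refine ⟨Finset.inter_subset_right, ?_⟩
      have h1 := Finset.card_lt_card hss
      have h2 := hone j hj
      have h3 := Finset.card_inter_add_card_sdiff (argminSet A l' j) P
      rw [Finset.inter_eq_right.2 hss.subset, Finset.sdiff_eq_inter_compl] at h3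
      omega
    refine ih _ ?_ l'' (covering_of_union (S := P) (fun i hi => ⟨j₀, ?_⟩) ⟨jc, hc'' jc hjc⟩)
      (fun j => ?_) rfl
    · rw [← hN]
      refine Finset.card_lt_card ((Finset.ssubset_iff_of_subset fun j hj => ?_).2 ⟨jn, ?_, ?_⟩)
      · simp only [Finset.mem_filter, Finset.mem_univ, true_and] at hj ⊢
        refine (hall' j).resolve_right fun h => ?_
        rw [hc'' j h] at hj
        exact hneP subset_rfl hj
      · simpa using hjnP
      · simp only [Finset.mem_filter, Finset.mem_univ, true_and]
        exact hneP (hu'' jn hjnP (by rwa [hjnP] at hjn')).1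
    · rw [hp'' j₀ hj₀]; exact hi
    · rcases hall' j with h | h
      · by_cases h' : argminSet A l' j = P
        · exact Or.inl (hp'' j h')
        · exact Or.inr (hu'' j h h')
      · rw [hc'' j h]; exact Or.inr ⟨subset_rfl, by omega⟩

/-- For a pair `P`, the union bound gives `|T \ P| ≥ 2` for every other support `T`, so lowering
`Pᶜ` slightly reaches the situation of `hasSpecial_of_pair_split`. -/
lemma hasSpecial_of_four_le_card_union {n : ℕ} {A : Matrix (Fin 6) (Fin n) ℝ}
    (hA : NoTriangular A) {l : Fin 6 → ℝ} (hcov : Covering A l)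
    (h2 : ∀ j, 2 ≤ (argminSet A l j).card)
    (h4 : ∀ j j', argminSet A l j ≠ argminSet A l j' →
      4 ≤ (argminSet A l j ∪ argminSet A l j').card) : HasSpecial A := by
  by_cases hpair : ∃ j, (argminSet A l j).card = 2
  · obtain ⟨jP, hP⟩ := hpair
    set P := argminSet A l jP with hPdef
    obtain ⟨l', hl'⟩ := exists_lower_slightly A l Pᶜ
    have hin : ∀ j, argminSet A l j ⊆ P → argminSet A l' j = P := fun j hj => by
      rw [(hl' j).2 (disjoint_compl_iff_subset.2 hj)]
      exact Finset.eq_of_subset_of_card_le hj (by rw [hP]; exact h2 j)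
    have hout : ∀ j, ¬ argminSet A l j ⊆ P → argminSet A l' j = argminSet A l j ∩ Pᶜ :=
      fun j hj => (hl' j).1 fun h => hj (disjoint_compl_iff_subset.1 h)
    refine hasSpecial_of_pair_split hA hP _ l' (fun i => ?_) (fun j => ?_) rfl
    · by_cases hi : i ∈ P
      · exact ⟨jP, by rwa [hin jP subset_rfl]⟩
      · obtain ⟨j, hj⟩ := hcov i
        exact ⟨j, by rw [hout j fun h => hi (h hj)]; simp [hj, hi]⟩
    · by_cases hj : argminSet A l j ⊆ P
      · exact Or.inl (hin j hj)
      · right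
        rw [hout j hj]
        refine ⟨Finset.inter_subset_right, ?_⟩
        have c : 4 ≤ (argminSet A l j ∪ P).card := h4 j jP (fun h => hj (h ▸ subset_rfl))
        have c1 := Finset.card_sdiff_add_card (argminSet A l j) P
        rw [Finset.sdiff_eq_inter_compl] at c1
        omega
  · push Not at hpair
    refine hasSpecial_of_three_le_card hA hcov fun j => ?_
    have := h2 j
    have := hpair j
    omega

lemma union_eq_of_subset_card_three {R S T : Finset (Fin 6)} (hR : R.card = 3) (hS : S ⊆ R)
    (hT : T ⊆ R) (hS2 : 2 ≤ S.card) (hT2 : 2 ≤ T.card) (hne : S ≠ T) : S ∪ T = R := by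
  refine Finset.eq_of_subset_of_card_le (Finset.union_subset hS hT) ?_
  rw [hR]
  exact lt_card_union hne hS2 hT2

/-- Induction on the number of columns inside `R`. If a single proper subset of `R` occurs, the
supports form a flag; otherwise `Rᶜ` is lowered until contact. -/
lemma hasSpecial_of_triple_split {n : ℕ} {A : Matrix (Fin 6) (Fin n) ℝ} (hA : NoTriangular A)
    {R : Finset (Fin 6)} (hR : R.card = 3) (N : ℕ) :
    ∀ l : Fin 6 → ℝ, (∃ j, argminSet A l j = Rᶜ) →
      (∀ j, argminSet A l j = Rᶜ ∨ argminSet A l j ⊆ R ∧ 2 ≤ (argminSet A l j).card) →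
      (∃ j j', argminSet A l j ≠ argminSet A l j' ∧ argminSet A l j ⊆ R ∧ argminSet A l j' ⊆ R) →
      (Finset.univ.filter fun j => argminSet A l j ⊆ R).card = N →
      HasSpecial A := by
  have hRc := card_compl_fin_six R
  induction N using Nat.strong_induction_on with
  | _ N ih =>
  rintro l ⟨jc, hjc⟩ hall ⟨j₁, j₂, hne, hj₁, hj₂⟩ hN
  have hcR : ¬ Rᶜ ⊆ R := fun h => by
    obtain ⟨x, hx⟩ := Finset.card_pos.1 (show 0 < Rᶜ.card by omega)
    exact Finset.mem_compl.1 hx (h hx)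
  have hcard : ∀ j, argminSet A l j ⊆ R → 2 ≤ (argminSet A l j).card := fun j hj =>
    (hall j).elim (fun h => absurd (h ▸ hj) hcR) (fun h => h.2)
  have hcov : Covering A l := covering_of_union (S := R) (fun i hi => by
    rw [← union_eq_of_subset_card_three hR hj₁ hj₂ (hcard _ hj₁) (hcard _ hj₂) hne] at hi
    exact (Finset.mem_union.1 hi).elim (fun h => ⟨j₁, h⟩) (fun h => ⟨j₂, h⟩)) ⟨jc, hjc⟩
  by_cases hflag : ∃ j, argminSet A l j ⊂ R ∧ ∀ j', argminSet A l j' ⊂ R →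
      argminSet A l j' = argminSet A l j
  · obtain ⟨jP, hP, hP'⟩ := hflag
    have hPc := Finset.card_lt_card hP
    have hPc' := hcard jP hP.subset
    refine ⟨l, hcov, .flag (argminSet A l jP) R (by omega) hR hP.subset ⟨jP, rfl⟩ ?_ ⟨jc, hjc⟩
      fun j => ?_⟩
    · by_contra! hno
      exact hne ((hP' j₁ (hj₁.ssubset_of_ne (hno j₁))).trans
        (hP' j₂ (hj₂.ssubset_of_ne (hno j₂))).symm)
    · rcases hall j with h | h
      · exact Or.inr (Or.inr h)
      · by_cases he : argminSet A l j = R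
        · exact Or.inr (Or.inl he)
        · exact Or.inl (hP' j (h.1.ssubset_of_ne he))
  obtain ⟨l', hl', jn, hjn, hjn'⟩ := exists_lower_until_contact A l (S := Rᶜ)
    (Finset.card_pos.1 (by omega)) ⟨j₁, disjoint_compl_iff_subset.2 hj₁⟩
  have hc' : ∀ j, argminSet A l j = Rᶜ → argminSet A l' j = Rᶜ := fun j hj => by
    rw [(hl' j).1 (by rw [disjoint_compl_iff_subset, hj]; exact hcR), hj, Finset.inter_self]
  have hp' : ∀ j, argminSet A l j ⊆ R → argminSet A l' j = argminSet A l j ∨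
      ∃ U ⊆ Rᶜ, U.Nonempty ∧ argminSet A l' j = argminSet A l j ∪ U := fun j hj =>
    (hl' j).2 (disjoint_compl_iff_subset.2 hj)
  have hsub : ∀ j, argminSet A l j ⊆ R → argminSet A l j ⊆ argminSet A l' j := fun j hj => by
    rcases hp' j hj with h | ⟨U, -, -, h⟩ <;> rw [h]
    exact Finset.subset_union_left
  have hback : ∀ j, argminSet A l' j ⊆ R → argminSet A l j ⊆ R ∧
      argminSet A l' j = argminSet A l j := fun j hj => by
    rcases hall j with h | h
    · rw [hc' j h] at hj; exact absurd hj hcR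
    · refine ⟨h.1, (hp' j h.1).resolve_right ?_⟩
      rintro ⟨U, hU, ⟨u, hu⟩, hT⟩
      exact Finset.mem_compl.1 (hU hu) (hj (hT ▸ Finset.mem_union_right _ hu))
  have hcov' : Covering A l' := covering_of_union (S := R) (fun i hi => by
    rw [← union_eq_of_subset_card_three hR hj₁ hj₂ (hcard _ hj₁) (hcard _ hj₂) hne] at hi
    exact (Finset.mem_union.1 hi).elim (fun h => ⟨j₁, hsub _ hj₁ h⟩)
      (fun h => ⟨j₂, hsub _ hj₂ h⟩)) ⟨jc, hc' jc hjc⟩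
  by_cases hstill : ∃ j j', argminSet A l' j ≠ argminSet A l' j' ∧ argminSet A l' j ⊆ R ∧
      argminSet A l' j' ⊆ R
  · obtain ⟨k₁, k₂, hk, hk₁, hk₂⟩ := hstill
    -- Two distinct supports remain inside `R`, so the touched columns can be turned into `Rᶜ`,
    -- which lowers the count.
    obtain ⟨l'', hS, hl''⟩ := exists_split hA hcov' (S := Rᶜ) (Finset.card_pos.1 (by omega)) hk
      (disjoint_compl_iff_subset.2 hk₁) (disjoint_compl_iff_subset.2 hk₂)
    have hin : ∀ j, argminSet A l' j ⊆ R → argminSet A l'' j = argminSet A l' j := fun j hj =>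
      (hl'' j).elim (fun h => absurd (disjoint_compl_iff_subset.2 hj) h.1) (fun h => h.2)
    refine ih _ ?_ l'' hS (fun j => ?_) ⟨k₁, k₂, by rwa [hin k₁ hk₁, hin k₂ hk₂],
      by rwa [hin k₁ hk₁], by rwa [hin k₂ hk₂]⟩ rfl
    · rw [← hN]
      have hin' : ∀ j, argminSet A l'' j ⊆ R → argminSet A l' j ⊆ R := fun j hj => by
        rcases hl'' j with h | h
        · rw [h.2] at hj; exact absurd hj hcR
        · exact disjoint_compl_iff_subset.1 h.1
      refine Finset.card_lt_card ((Finset.ssubset_iff_of_subset fun j hj => ?_).2 ⟨jn, ?_, ?_⟩)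
      · simp only [Finset.mem_filter, Finset.mem_univ, true_and] at hj ⊢
        exact (hback j (hin' j hj)).1
      · simpa using disjoint_compl_iff_subset.1 hjn
      · simp only [Finset.mem_filter, Finset.mem_univ, true_and]
        exact fun h => hjn' (hback jn (hin' jn h)).2
    · rcases hl'' j with h | h
      · exact Or.inl h.2
      · right
        have h1 := disjoint_compl_iff_subset.1 h.1
        rw [h.2]
        refine ⟨h1, ?_⟩
        rw [(hback j h1).2]
        exact hcard j (hback j h1).1
  · push Not at hstill
    have h2' : ∀ j, 2 ≤ (argminSet A l' j).card := fun j => by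
      rcases hall j with h | h
      · rw [hc' j h]; omega
      · exact h.2.trans (Finset.card_le_card (hsub j h.1))
    -- At most one support remains inside `R`. Two distinct supports with a union `Q` of at most
    -- three elements would include a pair inside `R` and a set leaving `R`, so `Q` misses some `x ∈
    -- R`. The support `Rᶜ` meets `Qᶜ`, hence contains it, although `x ∈ Qᶜ`.
    refine hasSpecial_of_four_le_card_union hA hcov' h2' fun j j' hjj => ?_
    by_contra hlt
    wlog hpair : (argminSet A l' j).card = 2 generalizing j j'
    · refine this j' j hjj.symm (by rwa [Finset.union_comm]) ?_
      by_contra hpair'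
      have := h2' j
      have := h2' j'
      have := lt_card_union hjj (k := 3) (by omega) (by omega)
      omega
    have hjR : argminSet A l' j ⊆ R := by
      rcases hall j with h | h
      · rw [hc' j h] at hpair; omega
      · rw [← Finset.eq_of_subset_of_card_le (hsub j h.1) (by omega)]
        exact h.1
    have hj'R : ¬ argminSet A l' j' ⊆ R := hstill j j' hjj hjR
    have hU : (argminSet A l' j ∪ argminSet A l' j').card ≤ 3 := by omega
    have hj'c : argminSet A l j' ⊆ R := by
      rcases hall j' with h | h
      · rw [hc' j' h, Finset.card_union_of_disjoint (disjoint_compl_iff_subset.2 hjR)] at hU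
        omega
      · exact h.1
    set Q := argminSet A l' j ∪ argminSet A l' j' with hQ
    have hQR : ¬ R ⊆ Q := fun h => by
      have := Finset.eq_of_subset_of_card_le h (by omega)
      exact hj'R (this ▸ Finset.subset_union_right)
    obtain ⟨x, hxR, hxQ⟩ := Finset.not_subset.1 hQR
    have hsplit := subset_of_two_disjoint hA hcov' (S := Qᶜ) hjj
      (disjoint_compl_iff_subset.2 Finset.subset_union_left)
      (disjoint_compl_iff_subset.2 Finset.subset_union_right) (j := jc) (fun h => by
        have hs := disjoint_compl_iff_subset.1 h
        rw [hc' jc hjc] at hs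
        have hun : argminSet A l' j ∪ Rᶜ ⊆ Q := Finset.union_subset Finset.subset_union_left hs
        have := Finset.card_le_card hun
        rw [Finset.card_union_of_disjoint (disjoint_compl_iff_subset.2 hjR)] at this
        omega)
    rw [hc' jc hjc] at hsplit
    exact Finset.mem_compl.1 (hsplit (Finset.mem_compl.2 hxQ)) hxR

lemma hasSpecial_of_noTriangular {n : ℕ} [Nonempty (Fin n)] {A : Matrix (Fin 6) (Fin n) ℝ}
    (hA : NoTriangular A) : HasSpecial A := by
  obtain ⟨l, hcov, h2⟩ := exists_covering_two_le_card hA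
  by_cases hbad : ∀ j j', argminSet A l j ≠ argminSet A l j' →
      4 ≤ (argminSet A l j ∪ argminSet A l j').card
  · exact hasSpecial_of_four_le_card_union hA hcov h2 hbad
  push Not at hbad
  obtain ⟨j₁, j₂, hne, hlt⟩ := hbad
  set R := argminSet A l j₁ ∪ argminSet A l j₂ with hRdef
  have hs₁ : argminSet A l j₁ ⊆ R := Finset.subset_union_left
  have hs₂ : argminSet A l j₂ ⊆ R := Finset.subset_union_right
  have hR : R.card = 3 := by
    have : 2 < R.card := lt_card_union hne (h2 j₁) (h2 j₂)
    omega
  have hRc := card_compl_fin_six R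
  obtain ⟨l', hS, hl'⟩ := exists_split hA hcov (S := Rᶜ) (Finset.card_pos.1 (by omega)) hne
    (disjoint_compl_iff_subset.2 hs₁) (disjoint_compl_iff_subset.2 hs₂)
  have hk : ∀ j, argminSet A l j ⊆ R → argminSet A l' j = argminSet A l j := fun j hj =>
    (hl' j).elim (fun h => absurd (disjoint_compl_iff_subset.2 hj) h.1) (fun h => h.2)
  refine hasSpecial_of_triple_split hA hR _ l' hS (fun j => ?_) ⟨j₁, j₂, ?_, ?_, ?_⟩ rfl
  · rcases hl' j with h | h
    · exact Or.inl h.2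
    · rw [h.2]
      exact Or.inr ⟨disjoint_compl_iff_subset.1 h.1, h2 j⟩
  · rwa [hk j₁ hs₁, hk j₂ hs₂]
  · rwa [hk j₁ hs₁]
  · rwa [hk j₂ hs₂]

/-! ### Patterns and equivalence of matrices -/

lemma pattern_eq_zero_iff {n : ℕ} (A : Matrix (Fin 6) (Fin n) ℝ) (l : Fin 6 → ℝ)
    (σ : Equiv.Perm (Fin 6)) (i : Fin 6) (j : Fin n) :
    pattern (fun i j => A (σ i) j + l (σ i)) i j = 0 ↔ σ i ∈ argminSet A l j := by
  have h : pattern (fun i j => A (σ i) j + l (σ i)) i j = 0 ↔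
      ∀ k, A (σ i) j + l (σ i) ≤ A (σ k) j + l (σ k) := by
    unfold pattern
    split_ifs with h
    · refine ⟨fun _ k => ?_, fun _ => rfl⟩
      exact h.le.trans (Finset.inf'_le _ (Finset.mem_univ k))
    · refine ⟨fun h0 => absurd h0 WithTop.top_ne_zero, fun hk => absurd ?_ h⟩
      exact le_antisymm (Finset.le_inf' _ _ fun k _ => hk k) (Finset.inf'_le _ (Finset.mem_univ i))
  rw [h, mem_argminSet]
  exact ⟨fun h k => by simpa using h (σ.symm k), fun h k => h (σ k)⟩

lemma supp_pattern {n : ℕ} (A : Matrix (Fin 6) (Fin n) ℝ) (l : Fin 6 → ℝ)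
    (σ : Equiv.Perm (Fin 6)) (j : Fin n) :
    supp (pattern (fun i j => A (σ i) j + l (σ i))) j =
      (argminSet A l j).map σ.symm.toEmbedding := by
  ext i
  simp only [supp, Finset.mem_filter, Finset.mem_univ, true_and, pattern_eq_zero_iff,
    Finset.mem_map_equiv, Equiv.symm_symm]

lemma reflTransGen_addRows {n : ℕ} (A : Matrix (Fin 6) (Fin n) ℝ) (l : Fin 6 → ℝ) :
    Relation.ReflTransGen Step A (fun i j => A i j + l i) := by
  have key : ∀ s : Finset (Fin 6),
      Relation.ReflTransGen Step A (fun i j => A i j + if i ∈ s then l i else 0) := by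
    intro s
    induction s using Finset.induction_on with
    | empty => simpa using Relation.ReflTransGen.refl
    | insert a s ha ih =>
      refine ih.tail ?_
      have h := Step.addRow (fun i j => A i j + if i ∈ s then l i else 0) a (l a)
      refine Eq.subst (motive := Step _) ?_ h
      funext i j
      change Function.update (fun i j => A i j + if i ∈ s then l i else 0) a
        (fun j => l a + (A a j + if a ∈ s then l a else 0)) i j =
          A i j + if i ∈ insert a s then l i else 0
      by_cases hi : i = a
      · subst hi; simp [ha, add_comm]
      · simp [hi]
  simpa using key Finset.univ

lemma tropEquiv_scale_perm {n : ℕ} (A : Matrix (Fin 6) (Fin n) ℝ) (l : Fin 6 → ℝ)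
    (σ : Equiv.Perm (Fin 6)) : TropEquiv A (fun i j => A (σ i) j + l (σ i)) := by
  constructor
  · exact (reflTransGen_addRows A l).tail (Step.permRows _ σ)
  · have h := reflTransGen_addRows (fun i j => A i j + l i) (fun i => -l i)
    simp only [add_neg_cancel_right] at h
    refine Relation.ReflTransGen.head ?_ h
    have h' := Step.permRows (fun i j => A (σ i) j + l (σ i)) σ.symm
    refine Eq.subst (motive := Step _) ?_ h'
    funext i j
    change A (σ (σ.symm i)) j + l (σ (σ.symm i)) = A i j + l i
    rw [Equiv.apply_symm_apply]

/-! ### Normal forms under row permutations -/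

lemma exists_perm_of_nodup (a b c d e f : Fin 6) (h : [a, b, c, d, e, f].Nodup) :
    ∃ σ : Equiv.Perm (Fin 6),
      σ a = 0 ∧ σ b = 1 ∧ σ c = 2 ∧ σ d = 3 ∧ σ e = 4 ∧ σ f = 5 := by
  have hinj : Function.Injective ![a, b, c, d, e, f] := List.nodup_ofFn.1 (by simpa using h)
  set τ := Equiv.ofBijective _ (Finite.injective_iff_bijective.1 hinj) with hτ
  refine ⟨τ.symm, ?_, ?_, ?_, ?_, ?_, ?_⟩ <;> rw [Equiv.symm_apply_eq] <;> rfl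

lemma exists_perm_two_two {P Q : Finset (Fin 6)} (hP : P.card = 2) (hQ : Q.card = 2)
    (hPQ : Disjoint P Q) : ∃ σ : Equiv.Perm (Fin 6),
      P.map σ.toEmbedding = {0, 1} ∧ Q.map σ.toEmbedding = {2, 3} := by
  have hc := card_compl_fin_six (P ∪ Q)
  rw [Finset.card_union_of_disjoint hPQ] at hc
  obtain ⟨e, f, hef, hS⟩ := Finset.card_eq_two.1 (show (P ∪ Q)ᶜ.card = 2 by omega)
  obtain ⟨a, b, hab, rfl⟩ := Finset.card_eq_two.1 hP
  obtain ⟨c, d, hcd, rfl⟩ := Finset.card_eq_two.1 hQ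
  have he : e ∈ ({a, b} ∪ {c, d} : Finset (Fin 6))ᶜ := by rw [hS]; simp
  have hf : f ∈ ({a, b} ∪ {c, d} : Finset (Fin 6))ᶜ := by rw [hS]; simp
  simp only [Finset.mem_compl, Finset.mem_union, Finset.mem_insert, Finset.mem_singleton,
    Finset.disjoint_insert_left, Finset.disjoint_singleton_left, not_or] at he hf hPQ
  obtain ⟨σ, h0, h1, h2, h3, -⟩ := exists_perm_of_nodup a b c d e f (by
    simp; grind)
  exact ⟨σ, by simp [h0, h1], by simp [h2, h3]⟩

lemma exists_perm_three {P R : Finset (Fin 6)} (hP : P.card = 2) (hR : R.card = 3)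
    (hPR : P ⊆ R) : ∃ σ : Equiv.Perm (Fin 6),
      P.map σ.toEmbedding = {0, 1} ∧ R.map σ.toEmbedding = {0, 1, 2} := by
  have hc := card_compl_fin_six R
  obtain ⟨d, e, f, hde, hdf, hef, hS⟩ := Finset.card_eq_three.1 (show Rᶜ.card = 3 by omega)
  obtain ⟨c, hcP, hcR⟩ := (Finset.exists_eq_insert_iff (s := P) (t := R)).2 ⟨hPR, by omega⟩
  obtain ⟨a, b, hab, rfl⟩ := Finset.card_eq_two.1 hP
  have hd : d ∈ Rᶜ := by rw [hS]; simp
  have he : e ∈ Rᶜ := by rw [hS]; simp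
  have hf : f ∈ Rᶜ := by rw [hS]; simp
  rw [← hcR] at hd he hf
  simp only [Finset.mem_compl, Finset.mem_insert, Finset.mem_singleton, not_or] at hd he hf hcP
  obtain ⟨σ, h0, h1, h2, -⟩ := exists_perm_of_nodup a b c d e f (by simp; grind)
  refine ⟨σ, by simp [h0, h1], ?_⟩
  rw [← hcR]
  simp only [Finset.map_insert, Finset.map_singleton, Equiv.coe_toEmbedding, h0, h1, h2]
  decide

lemma exists_perm_cross {R T : Finset (Fin 6)} (hR : R.card = 3) (hT : T.card = 3)
    (hRT : (R ∩ T).card = 1) : ∃ σ : Equiv.Perm (Fin 6),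
      R.map σ.toEmbedding = {0, 1, 2} ∧ T.map σ.toEmbedding = {0, 3, 4} := by
  have hc := card_compl_fin_six (R ∪ T)
  have hu := Finset.card_union_add_card_inter R T
  have hr := Finset.card_inter_add_card_sdiff R T
  have ht := Finset.card_inter_add_card_sdiff T R
  rw [Finset.inter_comm] at ht
  obtain ⟨a, ha⟩ := Finset.card_eq_one.1 hRT
  obtain ⟨b, c, hbc, hRd⟩ := Finset.card_eq_two.1 (show (R \ T).card = 2 by omega)
  obtain ⟨d, e, hde, hTd⟩ := Finset.card_eq_two.1 (show (T \ R).card = 2 by omega)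
  obtain ⟨f, hf⟩ := Finset.card_eq_one.1 (show (R ∪ T)ᶜ.card = 1 by omega)
  have ma : a ∈ R ∩ T := by rw [ha]; simp
  have mb : b ∈ R \ T := by rw [hRd]; simp
  have mc : c ∈ R \ T := by rw [hRd]; simp
  have md : d ∈ T \ R := by rw [hTd]; simp
  have me : e ∈ T \ R := by rw [hTd]; simp
  have mf : f ∈ (R ∪ T)ᶜ := by rw [hf]; simp
  have eR : R = {a, b, c} := by
    rw [← Finset.sdiff_union_inter R T, hRd, ha]; ext; simp; tauto
  have eT : T = {a, d, e} := by
    rw [← Finset.sdiff_union_inter T R, hTd, Finset.inter_comm, ha]; ext; simp; tauto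
  simp only [Finset.mem_compl, Finset.mem_union, Finset.mem_inter, Finset.mem_sdiff, not_or]
    at ma mb mc md me mf
  obtain ⟨σ, h0, h1, h2, h3, h4, -⟩ := exists_perm_of_nodup a b c d e f (by
    simp; grind)
  exact ⟨σ, by rw [eR]; simp [h0, h1, h2], by rw [eT]; simp [h0, h3, h4]⟩

lemma map_compl_perm (σ : Equiv.Perm (Fin 6)) (R : Finset (Fin 6)) :
    Rᶜ.map σ.toEmbedding = (R.map σ.toEmbedding)ᶜ := by
  ext i; simp [Finset.mem_map_equiv]

/-- A triple through 0 would need two further points outside `{1, 2, 3, 4}`, where only 5 is left.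
So `G` consists of 5, one of 1, 2 and one of 3, 4. The two brackets are exchanged by swapping 3 and
4. -/
lemma mem_of_inter_card_eq_one : ∀ G : Finset (Fin 6), G.card = 3 →
    (G ∩ {0, 1, 2}).card = 1 → (G ∩ {0, 3, 4}).card = 1 →
      (G = {1, 3, 5} ∨ G = {2, 4, 5}) ∨ G = {1, 4, 5} ∨ G = {2, 3, 5} := by
  decide

/-- Triples meeting pairwise in one point are lines of a complete quadrilateral. -/
lemma exists_perm_quadrilateral {n : ℕ} {F : Fin n → Finset (Fin 6)}
    (h : ∀ j j', (F j).card = 3 → (F j').card = 3 → F j ≠ F j' → (F j ∩ F j').card = 1) :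
    ∃ σ : Equiv.Perm (Fin 6), ∀ j, (F j).card = 3 → (F j).map σ.toEmbedding ∈
      ({{0, 1, 2}, {0, 3, 4}, {1, 3, 5}, {2, 4, 5}} : Set (Finset (Fin 6))) := by
  simp only [Set.mem_insert_iff, Set.mem_singleton_iff]
  by_cases hone : ∃ j, (F j).card = 3
  swap
  · exact ⟨1, fun j hj => absurd ⟨j, hj⟩ hone⟩
  obtain ⟨j₁, hj₁⟩ := hone
  by_cases htwo : ∃ j, (F j).card = 3 ∧ F j ≠ F j₁
  swap
  · obtain ⟨P, hPR, hP⟩ := Finset.exists_subset_card_eq (show 2 ≤ (F j₁).card by omega)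
    obtain ⟨σ, -, hσ⟩ := exists_perm_three hP hj₁ hPR
    refine ⟨σ, fun j hj => Or.inl ?_⟩
    push Not at htwo
    rw [htwo j hj, hσ]
  obtain ⟨j₂, hj₂, hne⟩ := htwo
  obtain ⟨σ, hσ₁, hσ₂⟩ := exists_perm_cross hj₁ hj₂ (h j₁ j₂ hj₁ hj₂ hne.symm)
  have hmap : ∀ {τ : Equiv.Perm (Fin 6)} {j j'}, (F j).card = 3 → (F j').card = 3 →
      (F j).map τ.toEmbedding = (F j').map τ.toEmbedding ∨
      ((F j).map τ.toEmbedding ∩ (F j').map τ.toEmbedding).card = 1 := by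
    intro τ j j' hj hj'
    by_cases he : F j = F j'
    · exact Or.inl (by rw [he])
    · right
      rw [← Finset.map_inter, Finset.card_map]
      exact h j j' hj hj' he
  have hlines : ∀ {τ : Equiv.Perm (Fin 6)}, (F j₁).map τ.toEmbedding = {0, 1, 2} →
      (F j₂).map τ.toEmbedding = {0, 3, 4} → ∀ j, (F j).card = 3 →
      ((F j).map τ.toEmbedding = {0, 1, 2} ∨ (F j).map τ.toEmbedding = {0, 3, 4}) ∨
      ((F j).map τ.toEmbedding = {1, 3, 5} ∨ (F j).map τ.toEmbedding = {2, 4, 5}) ∨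
      (F j).map τ.toEmbedding = {1, 4, 5} ∨ (F j).map τ.toEmbedding = {2, 3, 5} := by
    intro τ h1 h2 j hj
    have e1 := hmap (τ := τ) hj hj₁
    have e2 := hmap (τ := τ) hj hj₂
    rw [h1] at e1
    rw [h2] at e2
    rcases e1 with e1 | e1
    · exact Or.inl (Or.inl e1)
    rcases e2 with e2 | e2
    · exact Or.inl (Or.inr e2)
    exact Or.inr (mem_of_inter_card_eq_one _ (by rwa [Finset.card_map]) e1 e2)
  -- A line from one bracket meets each line of the other bracket in two points, so a third line
  -- decides which bracket occurs.
  have hclose : ∀ {τ : Equiv.Perm (Fin 6)}, (F j₁).map τ.toEmbedding = {0, 1, 2} →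
      (F j₂).map τ.toEmbedding = {0, 3, 4} → (∃ j₃, (F j₃).card = 3 ∧
        ((F j₃).map τ.toEmbedding = {1, 3, 5} ∨ (F j₃).map τ.toEmbedding = {2, 4, 5})) →
      ∀ j, (F j).card = 3 → (F j).map τ.toEmbedding = {0, 1, 2} ∨
        (F j).map τ.toEmbedding = {0, 3, 4} ∨ (F j).map τ.toEmbedding = {1, 3, 5} ∨
        (F j).map τ.toEmbedding = {2, 4, 5} := by
    rintro τ h1 h2 ⟨j₃, hj₃, h3⟩ j hj
    have e3 := hmap (τ := τ) hj hj₃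
    rcases hlines h1 h2 j hj with (h4 | h4) | (h4 | h4) | h4 | h4
    · exact Or.inl h4
    · exact Or.inr (Or.inl h4)
    · exact Or.inr (Or.inr (Or.inl h4))
    · exact Or.inr (Or.inr (Or.inr h4))
    all_goals
      exfalso
      rw [h4] at e3
      rcases h3 with h3 | h3 <;> rw [h3] at e3 <;> revert e3 <;> decide
  by_cases hthree : ∃ j₃, (F j₃).card = 3 ∧
      ((F j₃).map σ.toEmbedding = {1, 4, 5} ∨ (F j₃).map σ.toEmbedding = {2, 3, 5})
  · obtain ⟨j₃, hj₃, h3⟩ := hthree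
    have hsw : ∀ j, (F j).map (σ.trans (Equiv.swap 3 4)).toEmbedding =
        ((F j).map σ.toEmbedding).map (Equiv.swap (3 : Fin 6) 4).toEmbedding := fun j => by
      rw [Finset.map_map]; rfl
    refine ⟨σ.trans (Equiv.swap 3 4), hclose (by rw [hsw, hσ₁]; decide)
      (by rw [hsw, hσ₂]; decide) ⟨j₃, hj₃, ?_⟩⟩
    rw [hsw]
    rcases h3 with h3 | h3
    · left; rw [h3]; decide
    · right; rw [h3]; decide
  · push Not at hthree
    refine ⟨σ, fun j hj => ?_⟩
    have := hthree j hj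
    have := hlines hσ₁ hσ₂ j hj
    tauto

lemma three_subset_mem_triples : ∀ G : Finset (Fin 6), G ⊆ {2, 3, 4, 5} → 3 ≤ G.card →
    (G = {3, 4, 5} ∨ G = {2, 3, 5} ∨ G = {2, 4, 5} ∨ G = {2, 3, 4}) ∨ G = {2, 3, 4, 5} := by
  decide

/-- Each configuration depends only on the supports, so `M` is arbitrary apart from the way `σ`
moves them. -/
lemma IsSpecial.exists_perm {n : ℕ} {F : Fin n → Finset (Fin 6)} (hF : IsSpecial F)
    {M : Equiv.Perm (Fin 6) → Matrix (Fin 6) (Fin n) (WithTop ℝ)}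
    (hM : ∀ σ j, supp (M σ) j = (F j).map σ.toEmbedding) :
    ∃ σ, CaseI (M σ) ∨ CaseII (M σ) ∨ CaseIII (M σ) ∨ CaseIV (M σ) ∨ CaseV (M σ) := by
  have hmem : ∀ {σ T}, (∃ j, F j = T) → T.map σ.toEmbedding ∈ supports (M σ) := by
    rintro σ T ⟨j, rfl⟩
    exact ⟨j, hM σ j⟩
  have hrange : ∀ {σ} {P Q R : Finset (Fin 6)}, (∃ j, F j = P) → (∃ j, F j = Q) →
      (∃ j, F j = R) → (∀ j, F j = P ∨ F j = Q ∨ F j = R) →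
      supports (M σ) = {P.map σ.toEmbedding, Q.map σ.toEmbedding, R.map σ.toEmbedding} := by
    intro σ P Q R hP hQ hR h
    refine Set.Subset.antisymm ?_ ?_
    · rintro _ ⟨j, rfl⟩
      rw [hM]
      rcases h j with h | h | h <;> simp [h]
    · rintro _ (rfl | rfl | rfl)
      exacts [hmem hP, hmem hQ, hmem hR]
  cases hF with
  | threePairs P Q hP hQ hPQ h₁ h₂ h₃ h =>
    obtain ⟨σ, hσP, hσQ⟩ := exists_perm_two_two hP hQ hPQ
    refine ⟨σ, Or.inl ?_⟩
    rw [CaseI, hrange h₁ h₂ h₃ h, map_compl_perm, Finset.map_union, hσP, hσQ,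
      show ({0, 1} ∪ {2, 3} : Finset (Fin 6))ᶜ = {4, 5} by decide]
  | pairTriples P hP h₁ h₂ h =>
    obtain ⟨c, hc⟩ := Finset.card_pos.1 (show 0 < Pᶜ.card by have := card_compl_fin_six P; omega)
    obtain ⟨σ, hσ, -⟩ := exists_perm_three (R := insert c P) hP
      (by rw [Finset.card_insert_of_notMem (Finset.mem_compl.1 hc), hP])
      (Finset.subset_insert c P)
    have hall : ∀ j, supp (M σ) j = {0, 1} ∨ supp (M σ) j ⊆ {2, 3, 4, 5} ∧
        3 ≤ (supp (M σ) j).card := fun j => by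
      rw [hM]
      rcases h j with h | h
      · left; rw [h, hσ]
      · right
        refine ⟨?_, by rw [Finset.card_map]; exact h.2⟩
        have := Finset.map_subset_map (f := σ.toEmbedding).2 h.1
        rwa [map_compl_perm, hσ, show ({0, 1} : Finset (Fin 6))ᶜ = {2, 3, 4, 5} by decide] at this
    refine ⟨σ, Or.inr (Or.inl ⟨hσ ▸ hmem h₁, ?_, ?_⟩)⟩
    · obtain ⟨j, hj⟩ := h₂
      refine ⟨supp (M σ) j, ?_, j, rfl⟩
      have hj3 : (supp (M σ) j).card = 3 := by rw [hM, Finset.card_map, hj]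
      rcases hall j with h | h
      · rw [h] at hj3; exact absurd hj3 (by decide)
      · rcases three_subset_mem_triples _ h.1 h.2 with h' | h'
        · exact h'
        · rw [h'] at hj3; exact absurd hj3 (by decide)
    · rintro _ ⟨j, rfl⟩
      exact (hall j).imp_right fun h => three_subset_mem_triples _ h.1 h.2
  | quadrilateral h₁ h₂ h₃ =>
    obtain ⟨σ, hσ⟩ := exists_perm_quadrilateral h₂
    refine ⟨σ, Or.inr (Or.inr (Or.inl ⟨?_, ?_⟩))⟩
    · rintro _ ⟨j, rfl⟩
      rw [hM, Finset.card_map]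
      rcases (h₁ j).eq_or_lt with h | h
      · exact Or.inl (hσ j h.symm)
      · exact Or.inr h
    · rintro _ ⟨j, rfl⟩ hj _ ⟨j', rfl⟩
      rw [hM, Finset.card_map] at hj
      rw [hM, hM, Finset.map_ssubset_map]
      exact h₃ j j' hj
  | disjointTriples R hR h₁ h₂ h =>
    obtain ⟨P, hPR, hP⟩ := Finset.exists_subset_card_eq (show 2 ≤ R.card by omega)
    obtain ⟨σ, -, hσ⟩ := exists_perm_three hP hR hPR
    have hσc : Rᶜ.map σ.toEmbedding = {3, 4, 5} := by
      rw [map_compl_perm, hσ]; decide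
    refine ⟨σ, Or.inr (Or.inr (Or.inr (Or.inl ⟨hσ ▸ hmem h₁, hσc ▸ hmem h₂, ?_⟩)))⟩
    rintro _ ⟨j, rfl⟩
    rw [hM, ← hσ, ← hσc, ← Finset.map_inter, ← Finset.map_inter, Finset.card_map,
      Finset.card_map]
    exact fun n1 n2 => h j (fun e => n1 (by rw [e])) (fun e => n2 (by rw [e]))
  | flag P R hP hR hPR h₁ h₂ h₃ h =>
    obtain ⟨σ, hσP, hσR⟩ := exists_perm_three hP hR hPR
    refine ⟨σ, Or.inr (Or.inr (Or.inr (Or.inr ?_)))⟩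
    rw [CaseV, hrange h₁ h₂ h₃ h, map_compl_perm, hσP, hσR,
      show ({0, 1, 2} : Finset (Fin 6))ᶜ = {3, 4, 5} by decide]

end Tropical3p1

/-- The bound `tropRank A ≤ 3` alone forces one of the five configurations; the hypothesis on the
Kapranov rank is not needed. -/
theorem theorem3p1 (n : ℕ) (A : Matrix (Fin 6) (Fin n) ℝ)
    (ht : Tropical3p1.tropRank A = 3) (hK : 3 < Tropical3p1.kapranovRank A) :
    ∃ W : Matrix (Fin 6) (Fin n) ℝ,
      Tropical3p1.TropEquiv A W ∧
      (∀ i : Fin 6, ∃ j : Fin n, Tropical3p1.pattern W i j = 0) ∧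
      (Tropical3p1.CaseI (Tropical3p1.pattern W) ∨
       Tropical3p1.CaseII (Tropical3p1.pattern W) ∨
       Tropical3p1.CaseIII (Tropical3p1.pattern W) ∨
       Tropical3p1.CaseIV (Tropical3p1.pattern W) ∨
       Tropical3p1.CaseV (Tropical3p1.pattern W)) := by
  have := Tropical3p1.columns_nonempty_of_tropRank ht
  obtain ⟨l, hcov, hl⟩ :=
    Tropical3p1.hasSpecial_of_noTriangular (Tropical3p1.noTriangular_of_tropRank ht)
  obtain ⟨σ, hσ⟩ := hl.exists_perm
    -- Reindexing the rows by `σ.symm` moves the supports by `σ` itself.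
    (M := fun σ => Tropical3p1.pattern fun i j => A (σ.symm i) j + l (σ.symm i))
    (fun σ j => Tropical3p1.supp_pattern A l σ.symm j)
  refine ⟨_, Tropical3p1.tropEquiv_scale_perm A l σ.symm, fun i => ?_, hσ⟩
  obtain ⟨j, hj⟩ := hcov (σ.symm i)
  exact ⟨j, (Tropical3p1.pattern_eq_zero_iff A l σ.symm i j).2 hj⟩
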